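/- A \emph{polyhedral complex} is a finite collection of cycles (of length $\ge 3$), called faces, together with their vertices and edges, such that any two different faces are disjoint, or meet in exactly one vertex, or meet in exactly one edge. It is a \emph{(polyhedral) map} if for each vertex $v$ the faces containing $v$ can be arranged in a cyclic order $C_1,\dots,C_m$, $m\ge 3$, in which cyclically consecutive faces share an edge at $v$, the $m$ edges obtained being distinct, and if moreover its geometric carrier is connected. (The geometric carrier is the union of polygons, one bounded by each face, glued along their common vertices and edges.) The map is on the torus or Klein bottle if its carrier is homeomorphic to that surface. It is \emph{semi-equivelar of type} $(a_1,\dots,a_m)$ if at every vertex the faces are, in cyclic order, an $a_1$-gon, an $a_2$-gon, \dots, an $a_m$-gon; exponents abbreviate repetitions, so $(4,8^2)=(4,8,8)$ and $(3^4,6)=(3,3,3,3,6)$. An isomorphism of maps is a bijection of the vertex sets under which a cycle is a face if and only if its image is a face. \textbf{Lemma.} Let $M$ be a semi-equivelar map on the torus or the Klein bottle with at most $20$ vertices. \begin{itemize} \item If $M$ has type $(3,4,6,4)$, then $M$ is isomorphic to $T_{1,18}(3,4,6,4)$ or to $K_{1,18}(3,4,6,4)$. \item If $M$ has type $(4,8^2)$,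 then $M$ is isomorphic to $T_{1,20}(4,8^2)$. \item If $M$ has type $(3^4,6)$, then $M$ is isomorphic to $T_{1,18}(3^4,6)$. \item $M$ does not have type $(3,6,3,6)$. \end{itemize} In particular, in the first and third case $M$ has $18$ vertices, and in the second $20$. Here the four maps are given by the following lists of faces, each face by its vertices in cyclic order. $T_{1,18}(3,4,6,4)$, with vertices $0,\dots,17$: $(0,7,8), (1,9,10), (2,11,12), (3,13,14), (4,15,16), (5,6,17), (0,1,9,8), (0,5,6,7), (1,2,11,10), (2,3,13,12), (3,4,15,14), (4,5,17,16), (6,11,12,17), (7,8,13,14), (9,10,15,16), (0,1,2,3,4,5), (6,7,14,15,10,11), (8,9,16,17,12,13)$. $K_{1,18}(3,4,6,4)$, with vertices $0,\dots,17$: $(0,7,8), (1,9,10), (2,11,12), (3,13,14), (4,15,16), (5,6,17), (0,1,9,8), (0,5,6,7), (1,2,11,10), (2,3,13,12), (3,4,15,14), (4,5,17,16), (6,10,9,17), (7,8,13,14), (11,12,16,15), (0,1,2,3,4,5), (6,7,14,15,11,10), (8,9,17,16,12,13)$. $T_{1,20}(4,8^2)$, with vertices $0,\dots,19$: $(0,7,8,9),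 (1,2,15,14), (3,4,10,11), (5,6,16,17), (12,13,19,18), (0,1,2,3,4,5,6,7), (0,1,14,13,12,11,10,9), (2,3,11,12,18,17,16,15), (4,5,17,18,19,8,9,10), (6,7,8,19,13,14,15,16)$. $T_{1,18}(3^4,6)$, with vertices $0,\dots,17$: $(0,1,8), (0,5,6), (0,6,7), (0,7,8), (1,2,10), (1,8,9), (1,9,10), (2,3,12), (2,10,11), (2,11,12), (3,4,14), (3,12,13), (3,13,14), (4,5,16), (4,14,15), (4,15,16), (5,6,17), (5,16,17), (6,7,13), (7,12,13), (8,9,15), (9,14,15), (10,11,17), (11,16,17), (0,1,2,3,4,5), (6,13,14,9,10,17), (7,8,15,16,11,12)$. -/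

import Mathlib

open scoped unitInterval

namespace PolyMap

section Complexes

variable {V W : Type*} [Fintype V] [DecidableEq V] [Fintype W] [DecidableEq W]

/-- The edge set of the closed walk through the vertices of `l`, in the order of `l`. For a
duplicate-free `l` of length `p ≥ 3` this is the edge set of a `p`-cycle. -/
def cycleEdges (l : List V) : Finset (Sym2 V) :=
  (List.zipWith (fun a b => s(a, b)) l (l.rotate 1)).toFinset

/-- `f` is the edge set of a cycle with at least three vertices. Cycles are represented by their
edge sets throughout; the number of vertices of such a cycle is `f.card`. -/
def IsCycle (f : Finset (Sym2 V)) : Prop :=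
  ∃ l : List V, l.Nodup ∧ 3 ≤ l.length ∧ f = cycleEdges l

/-- The vertices of a cycle. -/
def verts (f : Finset (Sym2 V)) : Finset V := f.biUnion Sym2.toFinset

/-- A collection `K` of faces is a (two-dimensional) polyhedral complex: the faces are cycles, and
any two different faces are disjoint, or meet in one vertex, or meet in one edge (of both). -/
def IsPolyhedralComplex (K : Finset (Finset (Sym2 V))) : Prop :=
  (∀ f ∈ K, IsCycle f) ∧
  ∀ f ∈ K, ∀ g ∈ K, f ≠ g →
    verts f ∩ verts g = ∅ ∨ (∃ v, verts f ∩ verts g = {v}) ∨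
      ∃ e, e ∈ f ∧ e ∈ g ∧ verts f ∩ verts g = e.toFinset

/-- `c 0, c 1, …, c (m - 1)` are the faces of `K` that contain `v`, listed once each, in a cyclic
order around `v`: `m ≥ 3`, cyclically consecutive faces share exactly one edge, which contains `v`,
and these `m` edges are different. -/
def IsUmbrella (K : Finset (Finset (Sym2 V))) (v : V) {m : ℕ} (c : Fin m → Finset (Sym2 V)) :
    Prop :=
  3 ≤ m ∧ Function.Injective c ∧ (∀ f, (∃ i, c i = f) ↔ f ∈ K ∧ v ∈ verts f) ∧
  ∃ e : Fin m → Sym2 V, Function.Injective e ∧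
    ∀ i, v ∈ e i ∧ c i ∩ c (finRotate m i) = {e i}

/-- A polyhedral 2-manifold with vertex set (all of) `V`. -/
def IsPolyhedralManifold (K : Finset (Finset (Sym2 V))) : Prop :=
  IsPolyhedralComplex K ∧ ∀ v : V, ∃ (m : ℕ) (c : Fin m → Finset (Sym2 V)), IsUmbrella K v c

/-- The geometric carrier `|K|`: for each face `f` of `K` a polygon with boundary cycle `f`, glued
along their common vertices and edges. The polygon of `f` is the cone over the cycle `f` with
apex `f`, that is, the union of the triangles spanned by `f` and the ends of an edge `e` of `f`,
in barycentric coordinates on the set of vertices and faces. -/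
def carrier (K : Finset (Finset (Sym2 V))) : Set (V ⊕ {f // f ∈ K} → ℝ) :=
  {x | x ∈ stdSimplex ℝ (V ⊕ {f // f ∈ K}) ∧
    ∃ f : {f // f ∈ K}, ∃ e ∈ f.1,
      (∀ v, x (Sum.inl v) ≠ 0 → v ∈ e) ∧ ∀ g, x (Sum.inr g) ≠ 0 → g = f}

/-- A polyhedral map with vertex set `V`: a (finite) polyhedral 2-manifold with connected
carrier. -/
def IsMap (K : Finset (Finset (Sym2 V))) : Prop :=
  IsPolyhedralManifold K ∧ ConnectedSpace (carrier K)

/-- The vertex `v` has face-sequence `s`: the faces around `v`, in cyclic order, are an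
`s[0]`-gon, an `s[1]`-gon, and so on. -/
def HasFaceSeq (K : Finset (Finset (Sym2 V))) (v : V) (s : List ℕ) : Prop :=
  ∃ c : Fin s.length → Finset (Sym2 V), IsUmbrella K v c ∧ ∀ i, (c i).card = s.get i

/-- A semi-equivelar map of type `s` with vertex set `V`. -/
def IsSEM (K : Finset (Finset (Sym2 V))) (s : List ℕ) : Prop :=
  IsMap K ∧ ∀ v : V, HasFaceSeq K v s

/-- Isomorphism: a bijection of the vertex sets under which a cycle is a face of `K` if and only
if its image is a face of `L`. The edges, being the edges of the faces, are then preserved too. -/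
def Isomorphic (K : Finset (Finset (Sym2 V))) (L : Finset (Finset (Sym2 W))) : Prop :=
  ∃ φ : V ≃ W, ∀ f : Finset (Sym2 V), f ∈ K ↔ f.image (Sym2.map φ) ∈ L

/-- Identification of the sides of the unit square that gives the Klein bottle. -/
inductive KleinRel : I × I → I × I → Prop
  | vertical (y : I) : KleinRel (0, y) (1, y)
  | horizontal (x : I) : KleinRel (x, 0) (σ x, 1)

/-- The Klein bottle, with the quotient topology. -/
abbrev KleinBottle : Type := Quot KleinRel

/-- `K` is a complex on the torus. -/
def OnTorus (K : Finset (Finset (Sym2 V))) : Prop :=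
  Nonempty (carrier K ≃ₜ Circle × Circle)

/-- `K` is a complex on the Klein bottle. -/
def OnKleinBottle (K : Finset (Finset (Sym2 V))) : Prop :=
  Nonempty (carrier K ≃ₜ KleinBottle)

end Complexes

/-- The complex whose faces are the cycles through the listed vertices. -/
def ofLists {n : ℕ} (L : List (List (Fin n))) : Finset (Finset (Sym2 (Fin n))) :=
  (L.map cycleEdges).toFinset

/-- The map `T_{1,18}(3,4,6,4)`; the number `i` stands for the vertex `v_i`. -/
def T18_3464 : Finset (Finset (Sym2 (Fin 18))) :=
  ofLists
    [[0, 7, 8], [1, 9, 10], [2, 11, 12], [3, 13, 14], [4, 15, 16], [5, 6, 17], [0, 1, 9, 8],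
    [0, 5, 6, 7], [1, 2, 11, 10], [2, 3, 13, 12], [3, 4, 15, 14], [4, 5, 17, 16],
    [6, 11, 12, 17], [7, 8, 13, 14], [9, 10, 15, 16], [0, 1, 2, 3, 4, 5],
    [6, 7, 14, 15, 10, 11], [8, 9, 16, 17, 12, 13]]

/-- The map `K_{1,18}(3,4,6,4)`; the number `i` stands for the vertex `v_i`. -/
def K18_3464 : Finset (Finset (Sym2 (Fin 18))) :=
  ofLists
    [[0, 7, 8], [1, 9, 10], [2, 11, 12], [3, 13, 14], [4, 15, 16], [5, 6, 17], [0, 1, 9, 8],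
    [0, 5, 6, 7], [1, 2, 11, 10], [2, 3, 13, 12], [3, 4, 15, 14], [4, 5, 17, 16],
    [6, 10, 9, 17], [7, 8, 13, 14], [11, 12, 16, 15], [0, 1, 2, 3, 4, 5],
    [6, 7, 14, 15, 11, 10], [8, 9, 17, 16, 12, 13]]

/-- The map `T_{1,20}(4,8^2)`; the number `i` stands for the vertex `v_i`. -/
def T20_488 : Finset (Finset (Sym2 (Fin 20))) :=
  ofLists
    [[0, 7, 8, 9], [1, 2, 15, 14], [3, 4, 10, 11], [5, 6, 16, 17], [12, 13, 19, 18],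
    [0, 1, 2, 3, 4, 5, 6, 7], [0, 1, 14, 13, 12, 11, 10, 9], [2, 3, 11, 12, 18, 17, 16, 15],
    [4, 5, 17, 18, 19, 8, 9, 10], [6, 7, 8, 19, 13, 14, 15, 16]]

/-- The map `T_{1,18}(3^4,6)`; the number `i` stands for the vertex `v_i`. -/
def T18_33336 : Finset (Finset (Sym2 (Fin 18))) :=
  ofLists
    [[0, 1, 8], [0, 5, 6], [0, 6, 7], [0, 7, 8], [1, 2, 10], [1, 8, 9], [1, 9, 10], [2, 3, 12],
    [2, 10, 11], [2, 11, 12], [3, 4, 14], [3, 12, 13], [3, 13, 14], [4, 5, 16], [4, 14, 15],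
    [4, 15, 16], [5, 6, 17], [5, 16, 17], [6, 7, 13], [7, 12, 13], [8, 9, 15], [9, 14, 15],
    [10, 11, 17], [11, 16, 17], [0, 1, 2, 3, 4, 5], [6, 13, 14, 9, 10, 17],
    [7, 8, 15, 16, 11, 12]]

end PolyMap

/-! The classification is a finite search evaluated by the kernel, combined with a proof that the
search overlooks nothing.

The cyclic order of faces at each vertex gives local constraints: the degree is the length of the
type, the number of `s`-gons at a vertex is the multiplicity of `s` in the type, every edge of a
face lies in a second face, and two faces with a common edge have sizes that are consecutive in the
type. Moreover, two vertices common to two different faces span an edge of both.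

A partial map is a list of cycles in natural-number labels, starting with a single `a`-gon. If an
edge lies in exactly one listed cycle, then in `M` it lies in a further, unlisted face; `grow` tries
all ways of writing down the remaining vertices of that face, each of them an old label or the next
unused one. The constraints discard only candidates that cannot occur in `M`, so some branch always
follows `M` itself. This is `grow_sound` for one face and `solve_sound` for the whole search. The
value `true` means that every branch either dies or ends in an accepted leaf, so the branch of `M`
ends in an accepted leaf.

At a leaf all faces around every label in use are listed. The leaf is accepted if all `n` labels are
in use and an explicit permutation matches it with a target. As there are at most `n` vertices, the
labels then exhaust them, every face is listed, and the permutation is an isomorphism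
(`isomorphic_of_isIso`). For `(4,8,8)` the bound is `n = 20`; for the types with hexagons, counting
incidences (`IsSemiEquivelar.mul_card_size`) excludes 19 and 20 vertices, so `n = 18` suffices. -/

namespace PolyMap

/-! ### The search algorithm -/

section Search

/-! The functions below are evaluated by the kernel; the recursors make this fast. -/

variable {α β : Type*}

/-- `List.any`, by the recursor. -/
noncomputable def anyOf (l : List α) (p : α → Bool) : Bool :=
  List.rec false (fun a _ ih => cond (p a) true ih) l

/-- `List.all`, by the recursor. -/
noncomputable def allOf (l : List α) (p : α → Bool) : Bool :=
  List.rec true (fun a _ ih => cond (p a) ih false) l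

/-- `List.filter`, by the recursor. -/
noncomputable def pick (l : List α) (p : α → Bool) : List α :=
  List.rec [] (fun a _ ih => cond (p a) (a :: ih) ih) l

/-- `List.length`, by the recursor. -/
noncomputable def len (l : List α) : ℕ := List.rec 0 (fun _ _ ih => Nat.succ ih) l

/-- `List.flatMap`, by the recursor. -/
noncomputable def gather (l : List α) (f : α → List β) : List β :=
  List.rec [] (fun a _ ih => List.rec ih (fun b _ ih' => b :: ih') (f a)) l

/-- Membership in a list of numbers. -/
noncomputable def hasVertex (G : List ℕ) (x : ℕ) : Bool := anyOf G (Nat.beq x)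

/-- A list without its repetitions. -/
noncomputable def distinct (l : List ℕ) : List ℕ :=
  List.rec [] (fun a _ ih => cond (hasVertex ih a) ih (a :: ih)) l

/-- The consecutive pairs of the closed walk that starts at `a`, is now at `b`, and goes on
through `l`. -/
def walkPairs (a : ℕ) : ℕ → List ℕ → List (ℕ × ℕ)
  | b, [] => [(b, a)]
  | b, c :: l => (b, c) :: walkPairs a c l

/-- The consecutive pairs of a cycle given by the list of its vertices. -/
def cyclePairs : List ℕ → List (ℕ × ℕ)
  | [] => []
  | a :: l => walkPairs a a l

/-- The neighbours of `x` in the cycle `G`. -/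
noncomputable def neighbours (G : List ℕ) (x : ℕ) : List ℕ :=
  gather (cyclePairs G) fun p =>
    cond (Nat.beq x p.1) [p.2] (cond (Nat.beq x p.2) [p.1] [])

/-- The listed cycles through `x`. -/
noncomputable def facesAt (Fs : List (List ℕ)) (x : ℕ) : List (List ℕ) :=
  pick Fs fun G => hasVertex G x

/-- The number of listed `s`-cycles through `x`. -/
noncomputable def countAt (Fs : List (List ℕ)) (s x : ℕ) : ℕ :=
  len (pick (facesAt Fs x) fun G => Nat.beq (len G) s)

/-- The neighbours of `x` in the listed cycles. -/
noncomputable def adjacent (Fs : List (List ℕ)) (x : ℕ) : List ℕ :=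
  distinct (gather (facesAt Fs x) fun G => neighbours G x)

/-- The vertices `y` for which exactly one of the listed cycles contains the edge `xy`. -/
noncomputable def openEnds (Fs : List (List ℕ)) (x : ℕ) : List ℕ :=
  pick (adjacent Fs x) fun y =>
    Nat.beq (len (pick (facesAt Fs x) fun G => hasVertex (neighbours G x) y)) 1

/-- `y` is in the list `l` of neighbours, or can still be added without exceeding degree `m`. -/
noncomputable def canJoin (m : ℕ) (l : List ℕ) (y : ℕ) : Bool :=
  cond (Nat.blt (len l) m) true (hasVertex l y)

/-- An `a`-gon and a `b`-gon can have a common edge. -/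
noncomputable def canShare (sides : List (ℕ × ℕ)) (a b : ℕ) : Bool :=
  anyOf sides fun p => cond (Nat.beq a p.1) (Nat.beq b p.2) false

/-- The vertex `j` can follow `last` in a partial `s`-cycle `last :: tl` that starts at `v`, as far
as intersections with the listed cycles are concerned; `full` tells that `j` completes the
cycle. -/
noncomputable def meetsWell (sides : List (ℕ × ℕ)) (Fs : List (List ℕ)) (s v last : ℕ)
    (tl : List ℕ) (full : Bool) (j : ℕ) : Bool :=
  allOf (facesAt Fs j) fun G =>
    match pick (last :: tl) (hasVertex G) with
    | [] => true
    -- Here `j` and `x` are both common to `G` and the new face, so they must be joined by an edge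
    -- of each. In the new cycle, `j` is next to `last` and, if it closes the cycle, to `v`.
    | [x] => canShare sides s (len G) && hasVertex (neighbours G j) x &&
        (Nat.beq x last || (full && Nat.beq x v))
    -- With `j` there would be at least three common vertices.
    | _ => false

/-- The neighbours of `last` in the listed cycles and in the partial cycle `last :: tl`. -/
noncomputable def adjacentLast (Fs : List (List ℕ)) (last : ℕ) (tl : List ℕ) : List ℕ :=
  match tl with
  | [] => adjacent Fs last
  | a :: _ => cond (hasVertex (adjacent Fs last) a) (adjacent Fs last) (a :: adjacent Fs last)

/-- Complete the partial `s`-cycle `last :: tl`, which starts at `v`, by `r` more vertices in all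
possible ways, and go on with `cont`. The labels in use are the numbers below `k`. -/
noncomputable def grow (m n : ℕ) (sides : List (ℕ × ℕ)) (Fs : List (List ℕ)) (v s c : ℕ)
    (cont : List (List ℕ) → ℕ → Bool) : ℕ → ℕ → ℕ → List ℕ → Bool
  | 0, k, last, tl =>
    cond (canJoin m (adjacentLast Fs last tl) v && canJoin m (adjacent Fs v) last)
      (cont ((last :: tl) :: Fs) k) true
  | r + 1, k, last, tl =>
    -- Once `last` has `m` known neighbours, the next vertex must be one of them.
    allOf (cond (Nat.blt (len (adjacentLast Fs last tl)) m) (List.range n)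
      (adjacentLast Fs last tl)) fun j =>
      -- The value `j = k` stands for a vertex not met before. Giving it the smallest unused label
      -- removes the freedom of relabelling.
      cond (Nat.ble j k && !hasVertex (last :: tl) j && Nat.blt (countAt Fs s j) c &&
        meetsWell sides Fs s v last tl (Nat.beq r 0) j && canJoin m (adjacent Fs j) last)
        (cond (Nat.beq j k)
          (grow m n sides Fs v s c cont r (Nat.succ j) j (last :: tl))
          (grow m n sides Fs v s c cont r k j (last :: tl)))
        true

/-- A heuristic choice of an edge that lies in exactly one of the listed cycles. -/
noncomputable def chooseEdge (m : ℕ) (Fs : List (List ℕ)) (vs : List ℕ) : ℕ × ℕ :=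
  (vs.foldl (fun best v =>
    cond (Nat.blt (len (facesAt Fs v)) m)
      ((openEnds Fs v).foldl (fun best w =>
        cond (Nat.blt best.1 (Nat.add (len (facesAt Fs v)) (len (facesAt Fs w))))
          (Nat.add (len (facesAt Fs v)) (len (facesAt Fs w)), v, w) best) best)
      best) (0, 0, 0)).2

/-- Search for all complexes that extend the listed cycles. -/
noncomputable def solve (m n : ℕ) (sizes sides : List (ℕ × ℕ)) (leaf : List (List ℕ) → ℕ → Bool) :
    ℕ → List (List ℕ) → ℕ → Bool
  -- Running out of fuel counts as failure, so `true` certifies a completed search.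
  | 0, _, _ => false
  | fuel + 1, Fs, k =>
    cond (allOf (List.range k) fun v => Nat.beq (len (facesAt Fs v)) m) (leaf Fs k)
    -- The faces at such a vertex have closed up too early; the branch is impossible and holds
    -- vacuously.
    (cond (anyOf (List.range k) fun v =>
      Nat.blt 0 (len (facesAt Fs v)) && Nat.blt (len (facesAt Fs v)) m && (openEnds Fs v).isEmpty)
      true
      (match chooseEdge m Fs (List.range k) with
      -- The chosen edge is tested here, so correctness does not depend on the heuristic.
      | (v, w) => hasVertex (openEnds Fs v) w && allOf sizes fun p =>
        cond (allOf (facesAt Fs v) (fun G => cond (hasVertex (neighbours G v) w)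
            (canShare sides p.1 (len G)) true) &&
          Nat.blt (countAt Fs p.1 v) p.2 && Nat.blt (countAt Fs p.1 w) p.2)
          (grow m n sides Fs v p.1 p.2 (solve m n sizes sides leaf fuel) (Nat.sub p.1 2) k w [v])
          true))

/-- The lists `F` and `G` describe the same cycle. -/
noncomputable def sameCycle (F G : List ℕ) : Bool :=
  allOf (cyclePairs F) (fun p => hasVertex (neighbours G p.1) p.2) &&
    allOf (cyclePairs G) (fun p => hasVertex (neighbours F p.1) p.2)

/-- The list `q` describes an isomorphism from the complex of `L` to that of `Fs`. -/
noncomputable def isIso {n : ℕ} (L : List (List (Fin n))) (Fs : List (List ℕ)) (q : List ℕ) :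
    Bool :=
  allOf L (fun l => anyOf Fs (sameCycle (l.map fun i : Fin n => q.getD i.val 0))) &&
    allOf Fs fun F => anyOf L fun l => sameCycle F (l.map fun i : Fin n => q.getD i.val 0)

/-- All labels are in use, and one of the targets is isomorphic to the complex of `Fs`, by one of
the given maps. -/
noncomputable def leafCheck {n : ℕ} (targets : List (List (List (Fin n)))) (maps : List (List ℕ))
    (Fs : List (List ℕ)) (k : ℕ) : Bool :=
  Nat.beq k n && anyOf targets fun L => anyOf maps fun q => isIso L Fs q

/-- The search for all complexes with at most `n` vertices, starting with an `a`-gon. -/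
noncomputable def search {n : ℕ} (m a : ℕ) (sizes sides : List (ℕ × ℕ))
    (targets : List (List (List (Fin n)))) (maps : List (List ℕ)) (fuel : ℕ) : Bool :=
  solve m n sizes sides (leafCheck targets maps) fuel [List.range a] a

end Search

/-! ### Specifications of the list functions -/

section SearchLemmas

variable {α β : Type*}

theorem anyOf_eq (l : List α) (p : α → Bool) : anyOf l p = l.any p := by
  induction l with
  | nil => rfl
  | cons a l ih =>
    change cond (p a) true (anyOf l p) = _
    rw [ih, List.any_cons]; cases p a <;> rfl

theorem allOf_eq (l : List α) (p : α → Bool) : allOf l p = l.all p := by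
  induction l with
  | nil => rfl
  | cons a l ih =>
    change cond (p a) (allOf l p) false = _
    rw [ih, List.all_cons]; cases p a <;> rfl

theorem pick_eq (l : List α) (p : α → Bool) : pick l p = l.filter p := by
  induction l with
  | nil => rfl
  | cons a l ih =>
    change cond (p a) (a :: pick l p) (pick l p) = _
    rw [ih, List.filter_cons]; cases p a <;> rfl

theorem len_eq (l : List α) : len l = l.length := by
  induction l with
  | nil => rfl
  | cons a l ih =>
    change Nat.succ (len l) = _
    rw [ih, List.length_cons]

theorem gather_eq (l : List α) (f : α → List β) : gather l f = l.flatMap f := by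
  induction l with
  | nil => rfl
  | cons a l ih =>
    have h : ∀ t : List β, List.rec (motive := fun _ => List β) (gather l f)
        (fun b _ ih' => b :: ih') t = t ++ gather l f := by
      intro t
      induction t with
      | nil => rfl
      | cons b t iht => exact congrArg (b :: ·) iht
    change List.rec (motive := fun _ => List β) (gather l f) (fun b _ ih' => b :: ih') (f a) = _
    rw [h, ih, List.flatMap_cons]

@[simp] theorem hasVertex_iff (G : List ℕ) (x : ℕ) : hasVertex G x = true ↔ x ∈ G := by
  simp [hasVertex, anyOf_eq]

theorem hasVertex_eq_false_iff (G : List ℕ) (x : ℕ) : hasVertex G x = false ↔ x ∉ G := by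
  rw [← hasVertex_iff, Bool.not_eq_true]

theorem distinct_cons (a : ℕ) (l : List ℕ) :
    distinct (a :: l) = cond (hasVertex (distinct l) a) (distinct l) (a :: distinct l) := rfl

@[simp] theorem mem_distinct (l : List ℕ) (x : ℕ) : x ∈ distinct l ↔ x ∈ l := by
  induction l generalizing x with
  | nil => rfl
  | cons a l ih' =>
    have ih := ih' x
    rw [distinct_cons]
    cases h : hasVertex (distinct l) a with
    | false => simp [ih]
    | true =>
      have h := (ih' a).1 ((hasVertex_iff _ _).1 h)
      simp only [cond_true, List.mem_cons, ih]
      exact ⟨Or.inr, fun h' => h'.elim (fun e => e ▸ h) id⟩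

theorem nodup_distinct (l : List ℕ) : (distinct l).Nodup := by
  induction l with
  | nil => exact List.nodup_nil
  | cons a l ih =>
    rw [distinct_cons]
    cases h : hasVertex (distinct l) a with
    | false => exact List.nodup_cons.2 ⟨(hasVertex_eq_false_iff _ _).1 h, ih⟩
    | true => exact ih

theorem mem_facesAt (Fs : List (List ℕ)) (x : ℕ) (F : List ℕ) :
    F ∈ facesAt Fs x ↔ F ∈ Fs ∧ x ∈ F := by
  simp [facesAt, pick_eq]

theorem mem_walkPairs {a b : ℕ} {l : List ℕ} {p : ℕ × ℕ} (h : p ∈ walkPairs a b l) :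
    p.1 ∈ b :: l ∧ p.2 ∈ a :: l := by
  induction l generalizing b with
  | nil => simp_all [walkPairs]
  | cons c l ih =>
    rcases List.mem_cons.1 h with rfl | h
    · simp
    · have := ih h
      simp only [List.mem_cons] at this ⊢
      tauto

theorem mem_cyclePairs {F : List ℕ} {p : ℕ × ℕ} (h : p ∈ cyclePairs F) : p.1 ∈ F ∧ p.2 ∈ F := by
  cases F with
  | nil => simp [cyclePairs] at h
  | cons a l => exact mem_walkPairs h

theorem mem_neighbours (G : List ℕ) (x y : ℕ) :
    y ∈ neighbours G x ↔ (x, y) ∈ cyclePairs G ∨ (y, x) ∈ cyclePairs G := by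
  rw [neighbours, gather_eq, List.mem_flatMap]
  constructor
  · rintro ⟨⟨a, b⟩, hp, h⟩
    cases h1 : Nat.beq x a with
    | true =>
      rw [Nat.beq_eq] at h1
      simp_all
    | false =>
      cases h2 : Nat.beq x b with
      | true =>
        have h2' := Nat.eq_of_beq_eq_true h2
        simp only [h1, h2, cond_true, cond_false, List.mem_singleton] at h
        subst h; subst h2'
        exact Or.inr hp
      | false => simp [h1, h2] at h
  · rintro (h | h)
    · exact ⟨_, h, by simp⟩
    · refine ⟨_, h, ?_⟩
      cases h1 : Nat.beq x y with
      | true => simp [Nat.eq_of_beq_eq_true h1]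
      | false => simp

theorem mem_adjacent (Fs : List (List ℕ)) (x y : ℕ) :
    y ∈ adjacent Fs x ↔ ∃ G ∈ Fs, x ∈ G ∧ y ∈ neighbours G x := by
  simp [adjacent, gather_eq, mem_facesAt, and_assoc]

end SearchLemmas

/-! ### Cycles as edge sets and as vertex lists -/

section Cycles

variable {V W : Type*} [DecidableEq V] [DecidableEq W]

omit [DecidableEq V] in
theorem zipWith_walk {γ : Type*} (f : ℕ → V) (g : V → V → γ) (a b : ℕ) (l : List ℕ) :
    List.zipWith g ((b :: l).map f) (l.map f ++ [f a]) =
      (walkPairs a b l).map fun p => g (f p.1) (f p.2) := by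
  induction l generalizing b with
  | nil => rfl
  | cons c l ih =>
    simp only [List.map_cons, List.cons_append, List.zipWith_cons_cons, walkPairs] at ih ⊢
    rw [ih]

theorem mem_cycleEdges_map (f : ℕ → V) (F : List ℕ) (e : Sym2 V) :
    e ∈ cycleEdges (F.map f) ↔ ∃ p ∈ cyclePairs F, e = s(f p.1, f p.2) := by
  cases F with
  | nil => simp [cycleEdges, cyclePairs]
  | cons a l =>
    have : (List.map f (a :: l)).rotate 1 = l.map f ++ [f a] := by simp
    rw [cycleEdges, this, zipWith_walk, List.mem_toFinset, List.mem_map]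
    exact exists_congr fun p => and_congr Iff.rfl eq_comm

theorem mem_cycleEdges (l : List V) (e : Sym2 V) :
    e ∈ cycleEdges l ↔ ∃ i, ∃ h : i < l.length,
      e = s(l[i], l[(i + 1) % l.length]'(Nat.mod_lt _ (by omega))) := by
  rw [cycleEdges, List.mem_toFinset, List.mem_iff_getElem]
  simp only [List.length_zipWith, List.length_rotate, min_self, List.getElem_zipWith,
    List.getElem_rotate]
  exact exists_congr fun i => exists_congr fun h => eq_comm

theorem card_cycleEdges {l : List V} (hl : l.Nodup) (h3 : 3 ≤ l.length) :
    (cycleEdges l).card = l.length := by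
  rw [cycleEdges, List.toFinset_card_of_nodup]
  · simp
  · rw [List.nodup_iff_injective_get]
    rintro ⟨i, hi⟩ ⟨j, hj⟩ hij
    have hi' : i < l.length := by simpa using hi
    have hj' : j < l.length := by simpa using hj
    simp only [List.get_eq_getElem, List.getElem_zipWith, List.getElem_rotate, Sym2.eq_iff,
      hl.getElem_inj_iff] at hij
    -- Resolving the wrap-around index turns the comparison of edges into linear arithmetic. Length
    -- at least 3 matters: in a closed walk of length 2 both edges coincide.
    have h : ∀ a < l.length, (a + 1) % l.length = a + 1 ∧ a + 1 < l.length ∨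
        (a + 1) % l.length = 0 ∧ a + 1 = l.length := by
      intro a ha
      rcases Nat.lt_or_ge (a + 1) l.length with h | h
      · exact Or.inl ⟨Nat.mod_eq_of_lt h, h⟩
      · have : a + 1 = l.length := by omega
        exact Or.inr ⟨by rw [this, Nat.mod_self], this⟩
    have h1 := h i hi'
    have h2 := h j hj'
    ext
    simp only
    omega

theorem verts_cycleEdges (l : List V) : verts (cycleEdges l) = l.toFinset := by
  ext v
  simp only [verts, Finset.mem_biUnion, Sym2.mem_toFinset, List.mem_toFinset]
  constructor
  · rintro ⟨e, he, hv⟩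
    obtain ⟨i, h, rfl⟩ := (mem_cycleEdges l e).1 he
    rcases Sym2.mem_iff.1 hv with rfl | rfl <;> exact List.getElem_mem _
  · intro hv
    obtain ⟨i, h, rfl⟩ := List.mem_iff_getElem.1 hv
    exact ⟨_, (mem_cycleEdges l _).2 ⟨i, h, rfl⟩, Sym2.mem_mk_left _ _⟩

theorem cycleEdges_map (f : V → W) (l : List V) :
    cycleEdges (l.map f) = (cycleEdges l).image (Sym2.map f) := by
  ext e
  rw [mem_cycleEdges, Finset.mem_image]
  constructor
  · rintro ⟨i, h, rfl⟩
    exact ⟨_, (mem_cycleEdges l _).2 ⟨i, by simpa using h, rfl⟩, by simp⟩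
  · rintro ⟨e', he', rfl⟩
    obtain ⟨i, h, rfl⟩ := (mem_cycleEdges l e').1 he'
    exact ⟨i, by simpa using h, by simp⟩

/-- Two positions in a cycle that are joined by an edge are consecutive. -/
theorem index_of_edge {l : List V} (hl : l.Nodup) {p q : ℕ} (hpq : p < q) (hq : q < l.length)
    (h : s(l[p], l[q]) ∈ cycleEdges l) : q = p + 1 ∨ p = 0 ∧ q + 1 = l.length := by
  obtain ⟨i, hi, h⟩ := (mem_cycleEdges _ _).1 h
  simp only [Sym2.eq_iff, hl.getElem_inj_iff] at h
  rcases Nat.lt_or_ge (i + 1) l.length with h' | h'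
  · rw [Nat.mod_eq_of_lt h'] at h
    omega
  · have : i + 1 = l.length := by omega
    rw [this, Nat.mod_self] at h
    omega

theorem edge_cons_cons {R l : List V} (x y : V) : s(x, y) ∈ cycleEdges (R ++ x :: y :: l) := by
  rw [mem_cycleEdges]
  refine ⟨R.length, by simp, ?_⟩
  have : (R.length + 1) % (R ++ x :: y :: l).length = R.length + 1 :=
    Nat.mod_eq_of_lt (by simp)
  simp only [this]
  rw [List.getElem_append_right (by omega), List.getElem_append_right (by omega)]
  simp

theorem edge_head_getLast {x : V} {l : List V} (hl : l ≠ []) :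
    s(x, l.getLast hl) ∈ cycleEdges (x :: l) := by
  rw [mem_cycleEdges]
  have h0 : 0 < l.length := List.length_pos_iff.2 hl
  refine ⟨l.length, by simp, ?_⟩
  have : (l.length + 1) % (x :: l).length = 0 := by simp
  simp only [this, List.getElem_cons_zero]
  rw [Sym2.eq_swap, List.getLast_eq_getElem]
  congr 1
  rw [List.getElem_cons, dif_neg (by omega)]

/-- At most two edges of a cycle contain a given vertex. -/
theorem IsCycle.eq_or_eq {f : Finset (Sym2 V)} (hf : IsCycle f) {v : V} {a b e : Sym2 V}
    (ha : a ∈ f) (hb : b ∈ f) (he : e ∈ f) (va : v ∈ a) (vb : v ∈ b) (ve : v ∈ e) (hab : a ≠ b) :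
    e = a ∨ e = b := by
  obtain ⟨l, hl, h3, rfl⟩ := hf
  rw [mem_cycleEdges] at ha hb he
  obtain ⟨i, hi, rfl⟩ := ha
  obtain ⟨j, hj, rfl⟩ := hb
  obtain ⟨k, hk, rfl⟩ := he
  have hv : v ∈ l := by
    rcases Sym2.mem_iff.1 va with rfl | rfl <;> exact List.getElem_mem _
  obtain ⟨n, hn, rfl⟩ := List.mem_iff_getElem.1 hv
  simp only [Sym2.mem_iff, hl.getElem_inj_iff] at va vb ve
  have h : ∀ a < l.length, (a + 1) % l.length = a + 1 ∧ a + 1 < l.length ∨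
      (a + 1) % l.length = 0 ∧ a + 1 = l.length := by
    intro a ha
    rcases Nat.lt_or_ge (a + 1) l.length with h | h
    · exact Or.inl ⟨Nat.mod_eq_of_lt h, h⟩
    · have : a + 1 = l.length := by omega
      exact Or.inr ⟨by rw [this, Nat.mod_self], this⟩
  have h1 := h i hi
  have h2 := h j hj
  have h4 := h k hk
  have hij : i ≠ j := by rintro rfl; exact hab rfl
  -- The vertex at position `n` lies only on the edges that start at `n` and at its cyclic
  -- predecessor; `i` and `j` already are these two.
  have : k = i ∨ k = j := by omega
  rcases this with rfl | rfl
  · exact Or.inl rfl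
  · exact Or.inr rfl

theorem IsCycle.card_verts {f : Finset (Sym2 V)} (hf : IsCycle f) : (verts f).card = f.card := by
  obtain ⟨l, hl, h3, rfl⟩ := hf
  rw [verts_cycleEdges, card_cycleEdges hl h3, List.toFinset_card_of_nodup hl]

theorem mem_verts {f : Finset (Sym2 V)} {v : V} : v ∈ verts f ↔ ∃ e ∈ f, v ∈ e := by
  simp [verts]

theorem cycleEdges_rotate (l : List V) (k : ℕ) : cycleEdges (l.rotate k) = cycleEdges l := by
  rw [cycleEdges, List.rotate_rotate, Nat.add_comm, ← List.rotate_rotate,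
    ← List.zipWith_rotate_distrib _ _ _ _ (by simp), cycleEdges]
  ext
  simp

theorem cycleEdges_reverse (l : List V) : cycleEdges l.reverse = cycleEdges l := by
  have h : ∀ l : List V, cycleEdges l.reverse ⊆ cycleEdges l := by
    intro l e he
    obtain ⟨i, hi, rfl⟩ := (mem_cycleEdges _ _).1 he
    rw [List.length_reverse] at hi
    rw [mem_cycleEdges]
    simp only [List.length_reverse, List.getElem_reverse]
    rcases Nat.lt_or_ge (i + 1) l.length with h | h
    · refine ⟨l.length - 2 - i, by omega, ?_⟩
      rw [Sym2.eq_swap]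
      have h1 : l.length - 1 - (i + 1) % l.length = l.length - 2 - i := by
        rw [Nat.mod_eq_of_lt h]; omega
      have h2 : l.length - 1 - i = (l.length - 2 - i + 1) % l.length := by
        rw [Nat.mod_eq_of_lt (by omega)]; omega
      simp only [h1, h2]
    · have h' : i + 1 = l.length := by omega
      refine ⟨l.length - 1, by omega, ?_⟩
      rw [Sym2.eq_swap]
      have h1 : l.length - 1 - (i + 1) % l.length = l.length - 1 := by
        rw [h', Nat.mod_self]; omega
      have h2 : l.length - 1 - i = (l.length - 1 + 1) % l.length := by
        rw [show l.length - 1 + 1 = l.length by omega, Nat.mod_self]; omega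
      simp only [h1, h2]
  refine (h l).antisymm ?_
  simpa using h l.reverse

/-- Every cycle can be listed so that it ends with a given edge. -/
theorem IsCycle.exists_list {f : Finset (Sym2 V)} (hf : IsCycle f) {u v : V} (h : s(u, v) ∈ f) :
    ∃ R : List V, (R ++ [u, v]).Nodup ∧ f = cycleEdges (R ++ [u, v]) := by
  obtain ⟨l, hl, h3, rfl⟩ := hf
  have key : ∀ (u v : V) (l : List V), l.Nodup → 3 ≤ l.length → ∀ i, ∀ hi : i < l.length,
      u = l[i] → v = l[(i + 1) % l.length]'(Nat.mod_lt _ (by omega)) →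
      ∃ R : List V, (R ++ [u, v]).Nodup ∧ cycleEdges l = cycleEdges (R ++ [u, v]) := by
    intro u v l hl h3 i hi hu hv
    have hlen : (l.rotate i).length = l.length := List.length_rotate ..
    match hr : l.rotate i with
    | [] => rw [hr] at hlen; simp at hlen; omega
    | [a] => rw [hr] at hlen; simp at hlen; omega
    | a :: b :: t =>
      have ha : a = u := by
        have : (l.rotate i)[0]'(by omega) = l[(0 + i) % l.length]'(Nat.mod_lt _ (by omega)) :=
          List.getElem_rotate ..
        simp only [hr, List.getElem_cons_zero, Nat.zero_add, Nat.mod_eq_of_lt hi] at this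
        rw [this, hu]
      have hb : b = v := by
        have : (l.rotate i)[1]'(by omega) = l[(1 + i) % l.length]'(Nat.mod_lt _ (by omega)) :=
          List.getElem_rotate ..
        simp only [hr, List.getElem_cons_succ, List.getElem_cons_zero, Nat.add_comm 1 i] at this
        rw [this, hv]
      subst ha hb
      have e : (l.rotate i).rotate 2 = t ++ [a, b] := by
        rw [hr]; simp [List.rotate_cons_succ]
      refine ⟨t, ?_, ?_⟩
      · rw [← e]; simpa using hl
      · rw [← e, cycleEdges_rotate, cycleEdges_rotate]
  obtain ⟨i, hi, hs⟩ := (mem_cycleEdges _ _).1 h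
  rcases Sym2.eq_iff.1 hs with ⟨hu, hv⟩ | ⟨hu, hv⟩
  · exact key u v l hl h3 i hi hu hv
  · obtain ⟨R, hR, e⟩ := key v u l hl h3 i hi hv hu
    -- If the list runs through the edge in the opposite direction, reversing puts `u, v` in front
    -- and a rotation by two moves them to the end.
    have e' : (R ++ [v, u]).reverse.rotate 2 = R.reverse ++ [u, v] := by
      simp [List.rotate_cons_succ]
    exact ⟨R.reverse, by rw [← e', List.nodup_rotate, List.nodup_reverse]; exact hR,
      by rw [e, ← e', cycleEdges_rotate, cycleEdges_reverse]⟩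

end Cycles

/-! ### Faces and edges around a vertex -/

section Local

variable {V : Type*} [Fintype V] [DecidableEq V]

/-- The faces of `M` that contain `v`. -/
def facesThrough (M : Finset (Finset (Sym2 V))) (v : V) : Finset (Finset (Sym2 V)) :=
  M.filter fun f => v ∈ verts f

omit [Fintype V] in
theorem mem_facesThrough {M : Finset (Finset (Sym2 V))} {v : V} {f : Finset (Sym2 V)} :
    f ∈ facesThrough M v ↔ f ∈ M ∧ v ∈ verts f := Finset.mem_filter

/-- A polyhedral complex in which the faces around every vertex have sizes `t`, in cyclic order. -/
structure IsSemiEquivelar (M : Finset (Finset (Sym2 V))) (t : List ℕ) : Prop where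
  complex : IsPolyhedralComplex M
  faceSeq : ∀ v, HasFaceSeq M v t

theorem IsSEM.isSemiEquivelar {M : Finset (Finset (Sym2 V))} {t : List ℕ} (h : IsSEM M t) :
    IsSemiEquivelar M t := ⟨h.1.1.1, h.2⟩

theorem finRotate_ne_self {m : ℕ} (hm : 2 ≤ m) (i : Fin m) : finRotate m i ≠ i := by
  obtain ⟨k, rfl⟩ := Nat.exists_eq_add_of_le' hm
  intro h
  have := congrArg Fin.val h
  rcases eq_or_ne i (Fin.last (k + 1)) with rfl | hi
  · simp at this
  · rw [coe_finRotate_of_ne_last hi] at this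
    omega

/-- `finRotate` is a single cycle on all indices, so the orbit of `i` is everything. This locates
the place around a vertex where a proper part of its faces ends. -/
theorem finRotate_closed {m : ℕ} {S : Set (Fin m)} {i : Fin m} (hi : i ∈ S)
    (h : ∀ j ∈ S, finRotate m j ∈ S) : S = Set.univ := by
  match m with
  | 0 => exact i.elim0
  | 1 => ext j; rw [Subsingleton.elim j i]; simpa using hi
  | n + 2 =>
    ext j
    simp only [Set.mem_univ, iff_true]
    have hc := (isCycle_finRotate (n := n)).sameCycle (finRotate_ne_self (by omega) i)
      (finRotate_ne_self (by omega) j)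
    obtain ⟨k, hk⟩ := hc.exists_nat_pow_eq
    have : ∀ k : ℕ, ((finRotate (n + 2)) ^ k) i ∈ S := by
      intro k
      induction k with
      | zero => simpa using hi
      | succ k ih => rw [pow_succ', Equiv.Perm.mul_apply]; exact h _ ih
    rw [← hk]
    exact this k

variable {M : Finset (Finset (Sym2 V))} {t : List ℕ}

/-- A cyclic arrangement of the faces and edges around a vertex. -/
structure Star (M : Finset (Finset (Sym2 V))) (t : List ℕ) (v : V)
    (c : Fin t.length → Finset (Sym2 V)) (e : Fin t.length → Sym2 V) : Prop where
  three : 3 ≤ t.length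
  face_inj : Function.Injective c
  face_iff : ∀ f, (∃ i, c i = f) ↔ f ∈ M ∧ v ∈ verts f
  edge_inj : Function.Injective e
  mem_edge : ∀ i, v ∈ e i
  inter : ∀ i, c i ∩ c (finRotate _ i) = {e i}
  card : ∀ i, (c i).card = t.get i

omit [Fintype V] in
theorem exists_star (h : HasFaceSeq M v t) : ∃ c e, Star M t v c e := by
  obtain ⟨c, ⟨h3, hc, hf, e, he, h⟩, hs⟩ := h
  exact ⟨c, e, h3, hc, hf, he, fun i => (h i).1, fun i => (h i).2, hs⟩

namespace Star

variable {v : V} {c : Fin t.length → Finset (Sym2 V)} {e : Fin t.length → Sym2 V}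

omit [Fintype V] in
theorem edge_mem (h : Star M t v c e) (i : Fin t.length) : e i ∈ c i :=
  (Finset.mem_inter.1 (h.inter i ▸ Finset.mem_singleton_self (e i))).1

omit [Fintype V] in
theorem edge_mem_next (h : Star M t v c e) (i : Fin t.length) : e i ∈ c (finRotate _ i) :=
  (Finset.mem_inter.1 (h.inter i ▸ Finset.mem_singleton_self (e i))).2

omit [Fintype V] in
/-- The edges at `v` of a face are those shared with the next and the previous face. -/
theorem edge_eq (h : Star M t v c e) (hM : ∀ f ∈ M, IsCycle f) {i : Fin t.length} {a : Sym2 V}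
    (ha : a ∈ c (finRotate _ i)) (hv : v ∈ a) : a = e i ∨ a = e (finRotate _ i) := by
  have hc := hM _ ((h.face_iff _).1 ⟨finRotate _ i, rfl⟩).1
  refine hc.eq_or_eq (h.edge_mem_next i) (h.edge_mem _) ha (h.mem_edge _) (h.mem_edge _) hv ?_
  exact fun h' => finRotate_ne_self (by have := h.three; omega) i (h.edge_inj h').symm

omit [Fintype V] in
-- A cycle has only two edges at `v`, and those of `c j` are shared with its two neighbours in the
-- cyclic order. Hence each edge at `v` lies in exactly two faces.
theorem mem_face_iff (h : Star M t v c e) (hM : ∀ f ∈ M, IsCycle f) {i j : Fin t.length}  :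
    e i ∈ c j ↔ j = i ∨ j = finRotate _ i := by
  constructor
  · intro hi
    obtain ⟨k, rfl⟩ := (finRotate _).surjective j
    rcases h.edge_eq hM hi (h.mem_edge i) with h' | h'
    · exact Or.inr (by rw [h.edge_inj h'])
    · exact Or.inl (h.edge_inj h').symm
  · rintro (rfl | rfl)
    · exact h.edge_mem _
    · exact h.edge_mem_next _

end Star

namespace IsSemiEquivelar

omit [Fintype V] in
theorem isCycle (h : IsSemiEquivelar M t) : ∀ f ∈ M, IsCycle f := h.complex.1

omit [Fintype V] in
-- The enumeration `c` is a size-preserving bijection from the positions of the type to the faces at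
-- `v`.
theorem card_filter (h : IsSemiEquivelar M t) (v : V) (p : ℕ → Prop) [DecidablePred p] :
    ((facesThrough M v).filter fun f => p f.card).card =
      (Finset.univ.filter fun i : Fin t.length => p (t.get i)).card := by
  obtain ⟨c, e, hs⟩ := exists_star (h.faceSeq v)
  rw [← Finset.card_map ⟨c, hs.face_inj⟩]
  congr 1
  ext f
  simp only [Finset.mem_filter, mem_facesThrough, Finset.mem_map, Finset.mem_univ, true_and,
    Function.Embedding.coeFn_mk]
  constructor
  · rintro ⟨hf, hp⟩
    obtain ⟨i, rfl⟩ := (hs.face_iff f).2 hf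
    exact ⟨i, hs.card i ▸ hp, rfl⟩
  · rintro ⟨i, hp, rfl⟩
    exact ⟨(hs.face_iff _).1 ⟨i, rfl⟩, hs.card i ▸ hp⟩

omit [Fintype V] in
theorem card_facesThrough (h : IsSemiEquivelar M t) (v : V) :
    (facesThrough M v).card = t.length := by
  simpa using h.card_filter v fun _ => True

omit [Fintype V] in
theorem card_facesThrough_size (h : IsSemiEquivelar M t) (v : V) (s : ℕ) :
    ((facesThrough M v).filter fun f => f.card = s).card = t.count s := by
  rw [h.card_filter v (· = s)]
  conv_rhs => rw [← List.map_get_finRange t]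
  rw [List.count_eq_countP, List.countP_map, List.countP_eq_length_filter]
  rw [← List.toFinset_card_of_nodup ((List.nodup_finRange _).filter _)]
  congr 1
  ext i
  simp

omit [Fintype V] in
/-- A vertex has at most as many neighbours as faces around it. -/
theorem card_neighbours_le (h : IsSemiEquivelar M t) (v : V) (N : Finset V)
    (hN : ∀ w ∈ N, ∃ f ∈ M, s(v, w) ∈ f) : N.card ≤ t.length := by
  obtain ⟨c, e, hs⟩ := exists_star (h.faceSeq v)
  -- Neighbours are counted through their edges to `v`, all of which occur among the `t.length`
  -- edges of the star.
  have hsub : N.image (fun w => s(v, w)) ⊆ Finset.univ.image e := by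
    intro a ha
    obtain ⟨w, hw, rfl⟩ := Finset.mem_image.1 ha
    obtain ⟨f, hf, hwf⟩ := hN w hw
    obtain ⟨j, rfl⟩ := (hs.face_iff f).2 ⟨hf, mem_verts.2 ⟨_, hwf, Sym2.mem_mk_left _ _⟩⟩
    obtain ⟨i, rfl⟩ := (finRotate _).surjective j
    rcases hs.edge_eq h.isCycle hwf (Sym2.mem_mk_left _ _) with h' | h' <;>
      exact Finset.mem_image.2 ⟨_, Finset.mem_univ _, h'.symm⟩
  have := Finset.card_le_card hsub
  rw [Finset.card_image_of_injective _ fun a b hab => Sym2.congr_right.1 hab,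
    Finset.card_image_of_injective _ hs.edge_inj] at this
  simpa using this

omit [Fintype V] in
/-- Every edge of a face lies in a second face. -/
theorem exists_other_face (h : IsSemiEquivelar M t) {f : Finset (Sym2 V)} (hf : f ∈ M)
    {a : Sym2 V} (ha : a ∈ f) : ∃ g ∈ M, g ≠ f ∧ a ∈ g := by
  obtain ⟨v, hv⟩ : ∃ v, v ∈ a := by
    induction a with | _ x y => exact ⟨x, Sym2.mem_mk_left _ _⟩
  obtain ⟨c, e, hs⟩ := exists_star (h.faceSeq v)
  obtain ⟨j, rfl⟩ := (hs.face_iff f).2 ⟨hf, mem_verts.2 ⟨_, ha, hv⟩⟩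
  obtain ⟨i, rfl⟩ := (finRotate _).surjective j
  have h2 : 2 ≤ t.length := by have := hs.three; omega
  rcases hs.edge_eq h.isCycle ha hv with rfl | rfl
  · exact ⟨c i, ((hs.face_iff _).1 ⟨i, rfl⟩).1,
      fun h' => finRotate_ne_self h2 i (hs.face_inj h').symm, hs.edge_mem i⟩
  · exact ⟨c (finRotate _ (finRotate _ i)), ((hs.face_iff _).1 ⟨_, rfl⟩).1,
      fun h' => finRotate_ne_self h2 _ (hs.face_inj h'), hs.edge_mem_next _⟩

omit [Fintype V] in
/-- The sizes of two faces with a common edge are consecutive in the type. -/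
theorem rel_of_common_edge (h : IsSemiEquivelar M t) {p : ℕ → ℕ → Prop}
    (hp : ∀ i : Fin t.length, p (t.get i) (t.get (finRotate _ i)) ∧
      p (t.get (finRotate _ i)) (t.get i))
    {f g : Finset (Sym2 V)} (hf : f ∈ M) (hg : g ∈ M) (hfg : f ≠ g) {a : Sym2 V} (haf : a ∈ f)
    (hag : a ∈ g) : p f.card g.card := by
  obtain ⟨v, hv⟩ : ∃ v, v ∈ a := by
    induction a with | _ x y => exact ⟨x, Sym2.mem_mk_left _ _⟩
  obtain ⟨c, e, hs⟩ := exists_star (h.faceSeq v)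
  obtain ⟨j, rfl⟩ := (hs.face_iff f).2 ⟨hf, mem_verts.2 ⟨_, haf, hv⟩⟩
  obtain ⟨k, rfl⟩ := (hs.face_iff g).2 ⟨hg, mem_verts.2 ⟨_, hag, hv⟩⟩
  obtain ⟨n, rfl⟩ : ∃ n, a = e n := by
    obtain ⟨i, rfl⟩ := (finRotate _).surjective j
    rcases hs.edge_eq h.isCycle haf hv with h' | h' <;> exact ⟨_, h'⟩
  rw [hs.mem_face_iff h.isCycle] at haf hag
  rw [hs.card, hs.card]
  rcases haf with rfl | rfl <;> rcases hag with rfl | rfl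
  · exact absurd rfl hfg
  · exact (hp _).1
  · exact (hp _).2
  · exact absurd rfl hfg

omit [Fintype V] in
/-- If `A` contains some, but not all of the faces around `v`, then there is an edge at `v` that
lies in exactly one member of `A`. -/
theorem exists_boundary_edge (h : IsSemiEquivelar M t) {v : V} {A : Finset (Finset (Sym2 V))}
    (hA : A ⊂ facesThrough M v) (hne : A.Nonempty) :
    ∃ w, ∃ g ∈ A, s(v, w) ∈ g ∧ ∀ f ∈ A, s(v, w) ∈ f → f = g := by
  obtain ⟨c, e, hs⟩ := exists_star (h.faceSeq v)
  obtain ⟨g, hg⟩ := hne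
  obtain ⟨f, hf, hfA⟩ := Finset.exists_of_ssubset hA
  obtain ⟨i, rfl⟩ := (hs.face_iff g).2 (mem_facesThrough.1 (hA.1 hg))
  obtain ⟨j, rfl⟩ := (hs.face_iff f).2 (mem_facesThrough.1 hf)
  -- Going around `v`, at some point one leaves `A`; the edge crossed there is the required one.
  have : ∃ n, c n ∈ A ∧ c (finRotate _ n) ∉ A := by
    by_contra! hcon
    have := finRotate_closed (S := {n | c n ∈ A}) hg hcon
    exact hfA (this ▸ Set.mem_univ j : j ∈ {n | c n ∈ A})
  obtain ⟨n, hn, hn'⟩ := this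
  obtain ⟨w, hw⟩ := hs.mem_edge n
  refine ⟨w, c n, hn, hw ▸ hs.edge_mem n, fun f hf hwf => ?_⟩
  obtain ⟨k, rfl⟩ := (hs.face_iff f).2 (mem_facesThrough.1 (hA.1 hf))
  rw [← hw, hs.mem_face_iff h.isCycle] at hwf
  rcases hwf with rfl | rfl
  · rfl
  · exact absurd hf hn'

/-- Counting the incidences of vertices and `s`-gons. -/
theorem mul_card_size (h : IsSemiEquivelar M t) (s : ℕ) :
    s * (M.filter fun f => f.card = s).card = t.count s * Fintype.card V := by
  have := Finset.sum_card_bipartiteAbove_eq_sum_card_bipartiteBelow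
    (s := M.filter fun f => f.card = s) (t := (Finset.univ : Finset V)) (fun f v => v ∈ verts f)
  rw [Finset.sum_congr rfl (g := fun _ => s), Finset.sum_congr (s₁ := Finset.univ) rfl
    (g := fun _ => t.count s)] at this
  · simpa [mul_comm] using this
  · intro v _
    rw [← h.card_facesThrough_size v s]
    congr 1
    ext f
    simp only [Finset.mem_bipartiteBelow, Finset.mem_filter, mem_facesThrough]
    tauto
  · intro f hf
    obtain ⟨hfM, rfl⟩ := Finset.mem_filter.1 hf
    rw [← (h.isCycle f hfM).card_verts]
    congr 1
    ext v
    simp [Finset.mem_bipartiteAbove]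

end IsSemiEquivelar

end Local

/-! ### Partial labellings of a map -/

section Labelled

variable {V : Type*} [DecidableEq V]

/-- `φ` labels some vertices by the numbers below `k`, and the lists in `Fs` describe different
faces of `M` in these labels. -/
structure Labelled (M : Finset (Finset (Sym2 V))) (φ : ℕ → V) (k : ℕ) (Fs : List (List ℕ)) :
    Prop where
  inj : ∀ x < k, ∀ y < k, φ x = φ y → x = y
  mem : ∀ F ∈ Fs, cycleEdges (F.map φ) ∈ M
  nodup : ∀ F ∈ Fs, F.Nodup
  lt : ∀ F ∈ Fs, ∀ x ∈ F, x < k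
  three : ∀ F ∈ Fs, 3 ≤ F.length
  distinct : (Fs.map fun F => cycleEdges (F.map φ)).Nodup

omit [DecidableEq V] in
theorem map_nodup_of_inj {φ : ℕ → V} {k : ℕ} (h : ∀ x < k, ∀ y < k, φ x = φ y → x = y)
    {F : List ℕ} (hF : F.Nodup) (hk : ∀ x ∈ F, x < k) : (F.map φ).Nodup :=
  hF.map_on fun x hx y hy => h x (hk x hx) y (hk y hy)

theorem edge_mem_cycle_iff {φ : ℕ → V} {k : ℕ} (h : ∀ x < k, ∀ y < k, φ x = φ y → x = y)
    {F : List ℕ} (hk : ∀ x ∈ F, x < k) {x y : ℕ} (hx : x < k) (hy : y < k) :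
    s(φ x, φ y) ∈ cycleEdges (F.map φ) ↔ y ∈ neighbours F x := by
  rw [mem_cycleEdges_map, mem_neighbours]
  constructor
  · rintro ⟨⟨a, b⟩, hp, hs⟩
    have ha := hk _ (mem_cyclePairs hp).1
    have hb := hk _ (mem_cyclePairs hp).2
    rcases Sym2.eq_iff.1 hs with ⟨h1, h2⟩ | ⟨h1, h2⟩
    · rw [h _ hx _ ha h1, h _ hy _ hb h2]; exact Or.inl hp
    · rw [h _ hx _ hb h1, h _ hy _ ha h2]; exact Or.inr hp
  · rintro (hp | hp)
    · exact ⟨_, hp, rfl⟩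
    · exact ⟨_, hp, Sym2.eq_swap⟩

theorem mem_verts_cycle_iff {φ : ℕ → V} {k : ℕ} (h : ∀ x < k, ∀ y < k, φ x = φ y → x = y)
    {F : List ℕ} (hk : ∀ x ∈ F, x < k) {x : ℕ} (hx : x < k) :
    φ x ∈ verts (cycleEdges (F.map φ)) ↔ x ∈ F := by
  rw [verts_cycleEdges, List.mem_toFinset, List.mem_map]
  exact ⟨fun ⟨y, hy, e⟩ => h _ (hk y hy) _ hx e ▸ hy, fun hx => ⟨x, hx, rfl⟩⟩

namespace Labelled

variable {M : Finset (Finset (Sym2 V))} {φ : ℕ → V} {k : ℕ} {Fs : List (List ℕ)} {t : List ℕ}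

theorem card_eq (h : Labelled M φ k Fs) {F : List ℕ} (hF : F ∈ Fs) :
    (cycleEdges (F.map φ)).card = F.length := by
  rw [card_cycleEdges (map_nodup_of_inj h.inj (h.nodup F hF) (h.lt F hF))
    (by simpa using h.three F hF), List.length_map]

theorem edge_iff (h : Labelled M φ k Fs) {F : List ℕ} (hF : F ∈ Fs) {x y : ℕ} (hx : x < k)
    (hy : y < k) : s(φ x, φ y) ∈ cycleEdges (F.map φ) ↔ y ∈ neighbours F x :=
  edge_mem_cycle_iff h.inj (h.lt F hF) hx hy

theorem vert_iff (h : Labelled M φ k Fs) {F : List ℕ} (hF : F ∈ Fs) {x : ℕ} (hx : x < k) :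
    φ x ∈ verts (cycleEdges (F.map φ)) ↔ x ∈ F :=
  mem_verts_cycle_iff h.inj (h.lt F hF) hx

/-- The listed cycles use labels below `k` only, so redefining `φ` at `k` does not change the faces
they describe. -/
theorem extend (h : Labelled M φ k Fs) {x : V} (hx : ∀ j < k, φ j ≠ x) :
    Labelled M (Function.update φ k x) (k + 1) Fs := by
  have hlt : ∀ j < k, Function.update φ k x j = φ j := fun j hj =>
    Function.update_of_ne (by omega) _ _
  have hmap : ∀ F ∈ Fs, F.map (Function.update φ k x) = F.map φ := fun F hF =>
    List.map_congr_left fun j hj => hlt j (h.lt F hF j hj)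
  refine ⟨?_, fun F hF => hmap F hF ▸ h.mem F hF, h.nodup,
    fun F hF y hy => Nat.lt_succ_of_lt (h.lt F hF y hy), h.three, ?_⟩
  · intro a ha b hb hab
    rcases Nat.lt_succ_iff_lt_or_eq.1 ha with ha | rfl <;>
      rcases Nat.lt_succ_iff_lt_or_eq.1 hb with hb | rfl
    · rw [hlt a ha, hlt b hb] at hab
      exact h.inj a ha b hb hab
    · rw [hlt a ha, Function.update_self] at hab
      exact absurd hab (hx a ha)
    · rw [hlt b hb, Function.update_self] at hab
      exact absurd hab.symm (hx b hb)
    · rfl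
  · rw [List.map_congr_left fun F hF => congrArg cycleEdges (hmap F hF)]
    exact h.distinct

theorem cons (h : Labelled M φ k Fs) {F : List ℕ} (hF : F.Nodup) (hk : ∀ x ∈ F, x < k)
    (h3 : 3 ≤ F.length) (hM : cycleEdges (F.map φ) ∈ M)
    (hn : cycleEdges (F.map φ) ∉ Fs.map fun F => cycleEdges (F.map φ)) :
    Labelled M φ k (F :: Fs) where
  inj := h.inj
  mem := List.forall_mem_cons.2 ⟨hM, h.mem⟩
  nodup := List.forall_mem_cons.2 ⟨hF, h.nodup⟩
  lt := List.forall_mem_cons.2 ⟨hk, h.lt⟩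
  three := List.forall_mem_cons.2 ⟨h3, h.three⟩
  distinct := List.nodup_cons.2 ⟨hn, h.distinct⟩

/-- The faces of `M` described by the lists through the label `x`. -/
noncomputable def known (φ : ℕ → V) (Fs : List (List ℕ)) (x : ℕ) : Finset (Finset (Sym2 V)) :=
  ((facesAt Fs x).map fun F => cycleEdges (F.map φ)).toFinset

theorem mem_known {x : ℕ} {f : Finset (Sym2 V)} :
    f ∈ known φ Fs x ↔ ∃ F ∈ Fs, x ∈ F ∧ cycleEdges (F.map φ) = f := by
  simp [known, mem_facesAt, and_assoc]

theorem facesAt_nodup (h : Labelled M φ k Fs) (x : ℕ) :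
    ((facesAt Fs x).map fun F => cycleEdges (F.map φ)).Nodup := by
  refine h.distinct.sublist (List.Sublist.map _ ?_)
  rw [facesAt, pick_eq]
  exact List.filter_sublist

theorem card_known (h : Labelled M φ k Fs) (x : ℕ) :
    (known φ Fs x).card = len (facesAt Fs x) := by
  rw [known, List.toFinset_card_of_nodup (h.facesAt_nodup x), List.length_map, len_eq]

theorem known_subset (h : Labelled M φ k Fs) (x : ℕ) : known φ Fs x ⊆ facesThrough M (φ x) := by
  intro f hf
  obtain ⟨F, hF, hx, rfl⟩ := mem_known.1 hf
  exact mem_facesThrough.2 ⟨h.mem F hF, (h.vert_iff hF (h.lt F hF x hx)).2 hx⟩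

theorem eq_of_map_eq (h : Labelled M φ k Fs) {F G : List ℕ} (hF : F ∈ Fs) (hG : G ∈ Fs)
    (e : cycleEdges (F.map φ) = cycleEdges (G.map φ)) : F = G :=
  List.inj_on_of_nodup_map h.distinct hF hG e

/-- A vertex with some, but not all of its faces listed has an open end. -/
theorem openEnds_ne_nil (h : Labelled M φ k Fs) (hM : IsSemiEquivelar M t) {x : ℕ} (hx : x < k)
    (h0 : 0 < len (facesAt Fs x)) (hm : len (facesAt Fs x) < t.length) : openEnds Fs x ≠ [] := by
  have hss : known φ Fs x ⊂ facesThrough M (φ x) := by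
    refine Finset.ssubset_iff_subset_ne.2 ⟨h.known_subset x, fun e => ?_⟩
    have := congrArg Finset.card e
    rw [h.card_known, hM.card_facesThrough] at this
    omega
  obtain ⟨w, g, hg, hwg, huniq⟩ := hM.exists_boundary_edge hss
    (Finset.card_pos.1 (by rw [h.card_known]; exact h0))
  obtain ⟨G, hG, hxG, rfl⟩ := mem_known.1 hg
  have hw : w ∈ verts (cycleEdges (G.map φ)) := mem_verts.2 ⟨_, hwg, Sym2.mem_mk_right _ _⟩
  rw [verts_cycleEdges, List.mem_toFinset] at hw
  obtain ⟨y, hy, rfl⟩ := List.mem_map.1 hw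
  have hyk := h.lt G hG y hy
  have hn := (h.edge_iff hG hx hyk).1 hwg
  refine List.ne_nil_of_mem (a := y) ?_
  rw [openEnds, pick_eq, List.mem_filter, mem_adjacent]
  refine ⟨⟨G, hG, hxG, hn⟩, ?_⟩
  rw [Nat.beq_eq, len_eq, pick_eq, ← List.toFinset_card_of_nodup
    ((List.Nodup.of_map _ (h.facesAt_nodup x)).filter _), Finset.card_eq_one]
  refine ⟨G, ?_⟩
  ext F
  simp only [List.mem_toFinset, List.mem_filter, mem_facesAt, hasVertex_iff,
    Finset.mem_singleton]
  constructor
  · rintro ⟨⟨hF, hxF⟩, hyF⟩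
    exact h.eq_of_map_eq hF hG (huniq _ (mem_known.2 ⟨F, hF, hxF, rfl⟩)
      ((h.edge_iff hF hx hyk).2 hyF))
  · rintro rfl
    exact ⟨⟨hG, hxG⟩, hn⟩

/-- An open end belongs to a unique listed cycle. -/
theorem _root_.PolyMap.exists_of_mem_openEnds {Fs : List (List ℕ)} {x y : ℕ}
    (hy : y ∈ openEnds Fs x) : ∃ G ∈ Fs, x ∈ G ∧ y ∈ neighbours G x ∧
      ∀ F ∈ Fs, x ∈ F → y ∈ neighbours F x → F = G := by
  rw [openEnds, pick_eq, List.mem_filter, Nat.beq_eq, len_eq, pick_eq,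
    List.length_eq_one_iff] at hy
  obtain ⟨-, G, hG⟩ := hy
  have h : ∀ F, F ∈ Fs ∧ x ∈ F ∧ y ∈ neighbours F x ↔ F = G := by
    intro F
    rw [← List.mem_singleton, ← hG, List.mem_filter, mem_facesAt, hasVertex_iff, and_assoc]
  obtain ⟨h1, h2, h3⟩ := (h G).2 rfl
  exact ⟨G, h1, h2, h3, fun F hF hx hy => (h F).1 ⟨hF, hx, hy⟩⟩

/-- As `f` is not listed, the listed faces of its size at this vertex form a proper subset of all
such faces of `M`. -/
theorem countAt_lt (h : Labelled M φ k Fs) (hM : IsSemiEquivelar M t) {x : ℕ}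
    {f : Finset (Sym2 V)} (hf : f ∈ M) (hn : f ∉ Fs.map fun F => cycleEdges (F.map φ))
    (hv : φ x ∈ verts f) : countAt Fs f.card x < t.count f.card := by
  rw [countAt, len_eq, pick_eq, ← hM.card_facesThrough_size (φ x)]
  set L := (facesAt Fs x).filter fun G => Nat.beq (len G) f.card with hL
  have hnd : (L.map fun F => cycleEdges (F.map φ)).Nodup :=
    (h.facesAt_nodup x).sublist (List.filter_sublist.map _)
  rw [← List.length_map (as := L) fun F => cycleEdges (F.map φ),
    ← List.toFinset_card_of_nodup hnd]
  refine Finset.card_lt_card ⟨?_, fun hsub => ?_⟩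
  · intro g hg
    rw [List.mem_toFinset, List.mem_map] at hg
    obtain ⟨F, hF, rfl⟩ := hg
    rw [hL, List.mem_filter, Nat.beq_eq, len_eq, mem_facesAt] at hF
    obtain ⟨⟨hF, hx⟩, hs⟩ := hF
    rw [Finset.mem_filter]
    exact ⟨h.known_subset x (mem_known.2 ⟨F, hF, hx, rfl⟩), by rw [h.card_eq hF, hs]⟩
  · have := hsub (Finset.mem_filter.2 ⟨mem_facesThrough.2 ⟨hf, hv⟩, rfl⟩)
    rw [List.mem_toFinset, List.mem_map] at this
    obtain ⟨F, hF, rfl⟩ := this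
    rw [hL, List.mem_filter, mem_facesAt] at hF
    exact hn (List.mem_map.2 ⟨F, hF.1.1, rfl⟩)

theorem adjacent_spec (h : Labelled M φ k Fs) {x y : ℕ} (hy : y ∈ adjacent Fs x) :
    y < k ∧ ∃ f ∈ M, s(φ x, φ y) ∈ f := by
  obtain ⟨G, hG, hx, hn⟩ := (mem_adjacent Fs x y).1 hy
  have hyG : y ∈ G := by
    rcases (mem_neighbours G x y).1 hn with h' | h'
    · exact (mem_cyclePairs h').2
    · exact (mem_cyclePairs h').1
  have hyk := h.lt G hG y hyG
  exact ⟨hyk, _, h.mem G hG, (h.edge_iff hG (h.lt G hG x hx) hyk).2 hn⟩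

end Labelled

/-- A list of neighbours of a vertex is short, or contains every neighbour. -/
theorem canJoin_spec {M : Finset (Finset (Sym2 V))} {t : List ℕ} (hM : IsSemiEquivelar M t)
    {φ : ℕ → V} {k : ℕ} (hφ : ∀ x < k, ∀ y < k, φ x = φ y → x = y) {v : V} {l : List ℕ}
    (hl : l.Nodup) (hs : ∀ y ∈ l, y < k ∧ ∃ f ∈ M, s(v, φ y) ∈ f) {z : ℕ} (hz : z < k)
    (hvz : ∃ f ∈ M, s(v, φ z) ∈ f) : l.length < t.length ∨ z ∈ l := by
  by_contra! hcon
  -- Otherwise `z` together with `l` would give more neighbours than the degree allows.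
  have hnd : (z :: l).Nodup := List.nodup_cons.2 ⟨hcon.2, hl⟩
  have hall : ∀ y ∈ z :: l, y < k ∧ ∃ f ∈ M, s(v, φ y) ∈ f :=
    List.forall_mem_cons.2 ⟨⟨hz, hvz⟩, hs⟩
  have := hM.card_neighbours_le v ((z :: l).map φ).toFinset fun w hw => by
    obtain ⟨y, hy, rfl⟩ := List.mem_map.1 (List.mem_toFinset.1 hw)
    exact (hall y hy).2
  rw [List.toFinset_card_of_nodup (map_nodup_of_inj hφ hnd fun y hy => (hall y hy).1)] at this
  simp at this
  omega

theorem canJoin_eq_true {M : Finset (Finset (Sym2 V))} {t : List ℕ} (hM : IsSemiEquivelar M t)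
    {φ : ℕ → V} {k : ℕ} (hφ : ∀ x < k, ∀ y < k, φ x = φ y → x = y) {v : V} {l : List ℕ}
    (hl : l.Nodup) (hs : ∀ y ∈ l, y < k ∧ ∃ f ∈ M, s(v, φ y) ∈ f) {z : ℕ} (hz : z < k)
    (hvz : ∃ f ∈ M, s(v, φ z) ∈ f) : canJoin t.length l z = true := by
  rw [canJoin, len_eq]
  rcases canJoin_spec hM hφ hl hs hz hvz with h | h
  · rw [show Nat.blt l.length t.length = true by simpa using h, cond_true]
  · cases Nat.blt l.length t.length with
    | true => rfl
    | false => exact (hasVertex_iff _ _).2 h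

end Labelled

/-! ### No face of the map is missed when a cycle is grown -/

section Soundness

variable {V : Type*} [Fintype V] [DecidableEq V] {M : Finset (Finset (Sym2 V))} {t : List ℕ}
  {φ : ℕ → V} {k : ℕ} {Fs : List (List ℕ)} {sides : List (ℕ × ℕ)}

theorem Labelled.le_card (h : Labelled M φ k Fs) : k ≤ Fintype.card V := by
  have := Fintype.card_le_of_injective (fun i : Fin k => φ i) fun i j hij =>
    Fin.ext (h.inj _ i.2 _ j.2 hij)
  simpa using this

omit [Fintype V] in
/-- A vertex that is not labelled yet can be given the next label. -/
theorem Labelled.exists_label (h : Labelled M φ k Fs) (x : V) :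
    ∃ φ' j k', Labelled M φ' k' Fs ∧ (∀ y < k, φ' y = φ y) ∧ φ' j = x ∧ j ≤ k ∧ j < k' ∧
      k ≤ k' ∧ k' = if j = k then j + 1 else k := by
  by_cases hx : ∃ j < k, φ j = x
  · obtain ⟨j, hj, hjx⟩ := hx
    exact ⟨φ, j, k, h, fun _ _ => rfl, hjx, hj.le, hj, le_rfl, by rw [if_neg hj.ne]⟩
  · push Not at hx
    exact ⟨_, k, k + 1, h.extend hx, fun y hy => Function.update_of_ne hy.ne _ _,
      Function.update_self .., le_rfl, by omega, by omega, by rw [if_pos rfl]⟩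

omit [Fintype V] in
-- The test is the intersection axiom of a polyhedral complex, applied to the face `f` being traced
-- and each listed face through `j`. The list `R` holds the vertices of `f` still to be found, so
-- `j` completes the cycle exactly when `R` is empty.
theorem meetsWell_eq_true (h : Labelled M φ k Fs) (hM : IsSemiEquivelar M t)
    (hsides : ∀ f ∈ M, ∀ g ∈ M, f ≠ g → ∀ a, a ∈ f → a ∈ g →
      canShare sides f.card g.card = true)
    {f : Finset (Sym2 V)} (hf : f ∈ M) (hn : f ∉ Fs.map fun F => cycleEdges (F.map φ))
    {R : List V} {j last : ℕ} {tl : List ℕ} (hj : j < k) (hk : ∀ x ∈ last :: tl, x < k)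
    (hnd : (R ++ φ j :: (last :: tl).map φ).Nodup)
    (hfe : f = cycleEdges (R ++ φ j :: (last :: tl).map φ)) :
    meetsWell sides Fs f.card ((last :: tl).getLast (List.cons_ne_nil _ _)) last tl
      (Nat.beq R.length 0) j = true := by
  rw [meetsWell, allOf_eq, List.all_eq_true]
  intro G hG
  rw [mem_facesAt] at hG
  obtain ⟨hG, hjG⟩ := hG
  set g := cycleEdges (G.map φ) with hg
  have hgM : g ∈ M := h.mem G hG
  have hfg : f ≠ g := by
    rintro rfl
    exact hn (List.mem_map.2 ⟨G, hG, rfl⟩)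
  have hjg : φ j ∈ verts g := (h.vert_iff hG hj).2 hjG
  have hjf : φ j ∈ verts f := by rw [hfe, verts_cycleEdges]; simp
  -- A second common vertex `y` besides `j` leaves only the third alternative of the axiom: the
  -- intersection is the common edge from `y` to `j`.
  have hcom : ∀ y ∈ pick (last :: tl) (hasVertex G), y ∈ last :: tl ∧ φ y ≠ φ j ∧
      s(φ y, φ j) ∈ f ∧ s(φ y, φ j) ∈ g ∧ verts f ∩ verts g = s(φ y, φ j).toFinset := by
    intro y hy
    rw [pick_eq, List.mem_filter, hasVertex_iff] at hy
    obtain ⟨hy, hyG⟩ := hy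
    have hne : φ y ≠ φ j := by
      intro e
      have := (List.nodup_append.1 hnd).2.1
      exact (List.nodup_cons.1 this).1 (e ▸ List.mem_map_of_mem hy)
    have hyf : φ y ∈ verts f := by
      rw [hfe, verts_cycleEdges, List.mem_toFinset]
      exact List.mem_append_right _ (List.mem_cons_of_mem _ (List.mem_map_of_mem hy))
    have hyg : φ y ∈ verts g := (h.vert_iff hG (hk y hy)).2 hyG
    have h1 := Finset.mem_inter.2 ⟨hyf, hyg⟩
    have h2 := Finset.mem_inter.2 ⟨hjf, hjg⟩
    rcases hM.complex.2 f hf g hgM hfg with h' | ⟨u, h'⟩ | ⟨e, hef, heg, h'⟩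
    · simp [h'] at h1
    · rw [h', Finset.mem_singleton] at h1 h2
      exact absurd (h1.trans h2.symm) hne
    · have h1' := h1
      have h2' := h2
      rw [h', Sym2.mem_toFinset] at h1' h2'
      have : e = s(φ y, φ j) := (Sym2.mem_and_mem_iff hne).1 ⟨h1', h2'⟩
      subst this
      exact ⟨hy, hne, hef, heg, h'⟩
  have hPn : (pick (last :: tl) (hasVertex G)).Nodup := by
    rw [pick_eq]
    exact (List.Nodup.of_map φ (List.nodup_cons.1 (List.nodup_append.1 hnd).2.1).2).filter _
  rcases hP : pick (last :: tl) (hasVertex G) with _ | ⟨x, _ | ⟨y, P⟩⟩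
  · rfl
  · obtain ⟨hx, hne, hxf, hxg, -⟩ := hcom x (by simp [hP])
    have h1 : canShare sides f.card (len G) = true := by
      rw [len_eq, ← h.card_eq hG]
      exact hsides f hf g hgM hfg _ hxf hxg
    have h2 : hasVertex (neighbours G j) x = true := by
      rw [hasVertex_iff, ← h.edge_iff hG hj (hk x hx), Sym2.eq_swap]
      exact hxg
    have h3 : x = last ∨ R.length = 0 ∧ x = (last :: tl).getLast (List.cons_ne_nil _ _) := by
      obtain ⟨i, hi, hxi⟩ := List.mem_iff_getElem.1 hx
      set l := R ++ φ j :: (last :: tl).map φ with hl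
      have hlen : l.length = R.length + (tl.length + 2) := by simp [hl]
      have hi' : i < tl.length + 1 := by simpa using hi
      have e1 : l[R.length]'(by omega) = φ j := by simp [hl]
      have e2 : l[R.length + (i + 1)]'(by omega) = φ x := by
        simp only [hl]
        rw [List.getElem_append_right (by omega)]
        simp only [Nat.add_sub_cancel_left, List.getElem_cons_succ, List.getElem_map, hxi]
      have hedge : s(l[R.length]'(by omega), l[R.length + (i + 1)]'(by omega)) ∈
          cycleEdges l := by
        rw [e1, e2, ← hfe, Sym2.eq_swap]
        exact hxf
      rcases index_of_edge hnd (by omega) (by omega) hedge with h' | ⟨h', h''⟩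
      · left
        obtain rfl : i = 0 := by omega
        rw [← hxi, List.getElem_cons_zero]
      · right
        refine ⟨h', ?_⟩
        rw [← hxi, List.getLast_eq_getElem]
        congr 1
        rw [List.length_cons]
        omega
    simp only [h1, h2, Bool.and_true, Bool.true_and, Bool.or_eq_true, Bool.and_eq_true,
      Nat.beq_eq]
    exact h3
  · exfalso
    obtain ⟨-, hx, -, -, hI⟩ := hcom x (by simp [hP])
    obtain ⟨hyl, hy, hyf, hyg, hI'⟩ := hcom y (by simp [hP])
    have hxl := (hcom x (by simp [hP])).1
    -- Two further common vertices would give the intersection as two different edges at `j`.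
    have : φ y ∈ s(φ x, φ j).toFinset := by
      rw [← hI, hI', Sym2.mem_toFinset]
      exact Sym2.mem_mk_left _ _
    rw [Sym2.mem_toFinset, Sym2.mem_iff] at this
    rcases this with e | e
    · rw [hP] at hPn
      have := h.inj _ (hk y hyl) _ (hk x hxl) e
      subst this
      simp at hPn
    · exact hy e

omit [Fintype V] in
theorem adjacentLast_nodup (Fs : List (List ℕ)) (last : ℕ) (tl : List ℕ) :
    (adjacentLast Fs last tl).Nodup := by
  cases tl with
  | nil => exact nodup_distinct _
  | cons a tl =>
    change (cond (hasVertex (adjacent Fs last) a) _ _ : List ℕ).Nodup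
    cases h : hasVertex (adjacent Fs last) a with
    | true => exact nodup_distinct _
    | false => exact List.nodup_cons.2 ⟨(hasVertex_eq_false_iff _ _).1 h, nodup_distinct _⟩

omit [Fintype V] in
-- The predecessor of `last` in the unfinished cycle is already a neighbour, because the whole cycle
-- is a face of `M`.
theorem Labelled.adjacentLast_spec (h : Labelled M φ k Fs) {last : ℕ} {tl : List ℕ} {R : List V}
    (hk : ∀ x ∈ last :: tl, x < k) (hM : cycleEdges (R ++ (last :: tl).map φ) ∈ M) {y : ℕ}
    (hy : y ∈ adjacentLast Fs last tl) : y < k ∧ ∃ f ∈ M, s(φ last, φ y) ∈ f := by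
  cases tl with
  | nil => exact h.adjacent_spec hy
  | cons a tl =>
    have ha : a < k ∧ ∃ f ∈ M, s(φ last, φ a) ∈ f :=
      ⟨hk a (by simp), _, hM, edge_cons_cons _ _⟩
    change y ∈ (cond (hasVertex (adjacent Fs last) a) _ _ : List ℕ) at hy
    cases hh : hasVertex (adjacent Fs last) a with
    | true => rw [hh] at hy; exact h.adjacent_spec hy
    | false =>
      rw [hh] at hy
      rcases List.mem_cons.1 hy with rfl | hy
      · exact ha
      · exact h.adjacent_spec hy

/-- The invariant is that `R ++ (last :: tl).map φ` lists an actual unlisted face of `M`. The next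
vertex is the last entry of `R`, and each test of `grow` holds for it, so the branch taken by `M`
survives. Both `φ` and `k` vary in the induction, since this vertex may need a new label. -/
theorem grow_sound (hM : IsSemiEquivelar M t)
    (hsides : ∀ f ∈ M, ∀ g ∈ M, f ≠ g → ∀ a, a ∈ f → a ∈ g →
      canShare sides f.card g.card = true)
    {n : ℕ} (hn : Fintype.card V ≤ n) {P : Prop} {cont : List (List ℕ) → ℕ → Bool} {v s : ℕ}
    (hs : 3 ≤ s)
    (hcont : ∀ Fs k φ, cont Fs k = true → Labelled M φ k Fs → P) (r : ℕ) :
    ∀ (k last : ℕ) (tl : List ℕ) (φ : ℕ → V) (R : List V),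
      grow t.length n sides Fs v s (t.count s) cont r k last tl = true →
      Labelled M φ k Fs → (∀ x ∈ last :: tl, x < k) → tl ≠ [] →
      v = (last :: tl).getLast (List.cons_ne_nil _ _) → R.length = r →
      cycleEdges (R ++ (last :: tl).map φ) ∈ M →
      cycleEdges (R ++ (last :: tl).map φ) ∉ (Fs.map fun F => cycleEdges (F.map φ)) →
      (R ++ (last :: tl).map φ).Nodup → R.length + (last :: tl).length = s → P := by
  induction r with
  | zero =>
    intro k last tl φ R hg h hk htl hv hR hfM hfn hnd hlen
    obtain rfl := List.length_eq_zero_iff.1 hR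
    rw [List.nil_append] at hfM hfn hnd
    have hvk : v < k := hk v (hv ▸ List.getLast_mem _)
    have hedge : s(φ last, φ v) ∈ cycleEdges ((last :: tl).map φ) := by
      have htl' : tl.map φ ≠ [] := by simpa using htl
      have := edge_head_getLast (x := φ last) htl'
      rwa [List.getLast_map, ← List.getLast_cons htl, ← hv] at this
    have h1 : canJoin t.length (adjacentLast Fs last tl) v = true :=
      canJoin_eq_true hM h.inj (adjacentLast_nodup _ _ _)
        (fun y hy => h.adjacentLast_spec (R := []) hk hfM hy) hvk ⟨_, hfM, hedge⟩
    have h2 : canJoin t.length (adjacent Fs v) last = true :=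
      canJoin_eq_true hM h.inj (nodup_distinct _) (fun y hy => h.adjacent_spec hy)
        (hk last (by simp)) ⟨_, hfM, Sym2.eq_swap ▸ hedge⟩
    rw [grow, h1, h2, Bool.and_self, cond_true] at hg
    exact hcont _ _ _ hg (h.cons (List.Nodup.of_map φ hnd) hk (by simp at hlen ⊢; omega) hfM hfn)
  | succ r ih =>
    intro k last tl φ R hg h hk htl hv hR hfM hfn hnd hlen
    obtain rfl | ⟨R', x, rfl⟩ := List.eq_nil_or_concat' R
    · simp at hR
    -- The true next vertex `x` is found under its old label or receives the label `k`.
    obtain ⟨φ', j, k', h', hφ, hjx, hjk, hjk', hkk', hk'⟩ := h.exists_label x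
    have hR' : R'.length = r := by simpa using hR
    have hmap : (last :: tl).map φ = (last :: tl).map φ' :=
      List.map_congr_left fun y hy => (hφ y (hk y hy)).symm
    have hFs : (Fs.map fun F => cycleEdges (F.map φ)) = Fs.map fun F => cycleEdges (F.map φ') :=
      List.map_congr_left fun F hF => congrArg cycleEdges
        (List.map_congr_left fun y hy => (hφ y (h.lt F hF y hy)).symm)
    rw [hmap, ← hjx, List.append_assoc, List.singleton_append] at hfM hfn hnd
    rw [hFs] at hfn
    have hkl : ∀ y ∈ last :: tl, y < k' := fun y hy => (hk y hy).trans_le hkk'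
    have hcard : (cycleEdges (R' ++ φ' j :: (last :: tl).map φ')).card = s := by
      rw [card_cycleEdges hnd]
      · rw [← hlen]
        simp
        omega
      · rw [← hlen] at hs
        simp at hs ⊢
        omega
    have hjlast : s(φ' j, φ' last) ∈ cycleEdges (R' ++ φ' j :: (last :: tl).map φ') := by
      rw [List.map_cons]
      exact edge_cons_cons _ _
    have hadj : ∀ y ∈ adjacentLast Fs last tl, y < k' ∧ ∃ f ∈ M, s(φ' last, φ' y) ∈ f :=
      fun y hy => h'.adjacentLast_spec (R := R' ++ [φ' j]) hkl (by simpa using hfM) hy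
    have hjmem : j ∈ cond (Nat.blt (len (adjacentLast Fs last tl)) t.length) (List.range n)
        (adjacentLast Fs last tl) := by
      rw [len_eq]
      cases hb : Nat.blt (adjacentLast Fs last tl).length t.length with
      | true =>
        have := h'.le_card
        rw [cond_true, List.mem_range]
        omega
      | false =>
        refine (canJoin_spec hM h'.inj (adjacentLast_nodup Fs last tl) hadj hjk'
          ⟨_, hfM, Sym2.eq_swap ▸ hjlast⟩).resolve_left fun hlt => ?_
        rw [show Nat.blt _ _ = true by simpa using hlt] at hb
        exact Bool.noConfusion hb
    have hnot : j ∉ last :: tl := fun hj =>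
      (List.nodup_cons.1 (List.nodup_append.1 hnd).2.1).1 (List.mem_map_of_mem hj)
    have hcount : Nat.blt (countAt Fs s j) (t.count s) = true := by
      have := h'.countAt_lt hM hfM hfn (x := j)
        (by rw [verts_cycleEdges]; simp)
      rw [hcard] at this
      simpa using this
    have hmeets : meetsWell sides Fs s v last tl (Nat.beq r 0) j = true := by
      have := meetsWell_eq_true h' hM hsides hfM hfn hjk' hkl hnd rfl
      rwa [hcard, hR', ← hv] at this
    have hjoin : canJoin t.length (adjacent Fs j) last = true :=
      canJoin_eq_true hM h'.inj (nodup_distinct _) (fun y hy => h'.adjacent_spec hy)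
        (hkl last (by simp)) ⟨_, hfM, hjlast⟩
    rw [grow, allOf_eq, List.all_eq_true] at hg
    have hg := hg j hjmem
    rw [show Nat.ble j k = true by simpa using hjk,
      (hasVertex_eq_false_iff _ _).2 hnot, hcount, hmeets, hjoin] at hg
    simp only [Bool.not_false, Bool.and_self, cond_true] at hg
    -- The two recursive calls of `grow` correspond to the two values of `k'`.
    have hg' : grow t.length n sides Fs v s (t.count s) cont r k' j (last :: tl) = true := by
      rw [hk']
      split_ifs with hjk2
      · rwa [show Nat.beq j k = true by simpa using hjk2, cond_true] at hg
      · rwa [show Nat.beq j k = false by rw [← Bool.not_eq_true, Nat.beq_eq]; exact hjk2,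
          cond_false] at hg
    refine ih k' j (last :: tl) φ' R' hg' h' (List.forall_mem_cons.2 ⟨hjk', hkl⟩)
      (List.cons_ne_nil _ _) ?_ hR' hfM hfn hnd ?_
    · rw [List.getLast_cons (List.cons_ne_nil _ _)]
      exact hv
    · rw [← hlen]
      simp
      omega

end Soundness

/-! ### Soundness of the whole search, and isomorphism at the leaves -/

section Classification

variable {V : Type*} [Fintype V] [DecidableEq V] {M : Finset (Finset (Sym2 V))} {t : List ℕ}
  {sizes sides : List (ℕ × ℕ)} {n : ℕ}

/-- By induction on the fuel: the second face of `M` at the chosen edge is one of the candidates,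
and `grow_sound` passes to the search with that face added. -/
theorem solve_sound (hM : IsSemiEquivelar M t) (ht : ∀ s ∈ t, (s, t.count s) ∈ sizes)
    (hsides : ∀ f ∈ M, ∀ g ∈ M, f ≠ g → ∀ a, a ∈ f → a ∈ g →
      canShare sides f.card g.card = true)
    (hn : Fintype.card V ≤ n) {leaf : List (List ℕ) → ℕ → Bool} {P : Prop}
    (hleaf : ∀ Fs k φ, leaf Fs k = true → Labelled M φ k Fs →
      (∀ x < k, len (facesAt Fs x) = t.length) → P) (fuel : ℕ) :
    ∀ (Fs : List (List ℕ)) (k : ℕ) (φ : ℕ → V),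
      solve t.length n sizes sides leaf fuel Fs k = true → Labelled M φ k Fs → P := by
  induction fuel with
  | zero => intro Fs k φ h; exact absurd h Bool.false_ne_true
  | succ fuel ih =>
    intro Fs k φ hg h
    rw [solve] at hg
    cases h1 : allOf (List.range k) fun v => Nat.beq (len (facesAt Fs v)) t.length with
    | true =>
      rw [h1, cond_true] at hg
      rw [allOf_eq, List.all_eq_true] at h1
      exact hleaf Fs k φ hg h fun x hx => by simpa using h1 x (List.mem_range.2 hx)
    | false =>
      rw [h1, cond_false] at hg
      cases h2 : anyOf (List.range k) fun v => Nat.blt 0 (len (facesAt Fs v)) &&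
          Nat.blt (len (facesAt Fs v)) t.length && (openEnds Fs v).isEmpty with
      | true =>
        rw [anyOf_eq, List.any_eq_true] at h2
        obtain ⟨x, hx, hx'⟩ := h2
        simp only [Bool.and_eq_true, Nat.blt_eq, List.isEmpty_iff] at hx'
        exact absurd hx'.2 (h.openEnds_ne_nil hM (List.mem_range.1 hx) hx'.1.1 hx'.1.2)
      | false =>
        rw [h2, cond_false] at hg
        -- Nothing about the choice is used beyond the explicit test for an open end.
        generalize chooseEdge t.length Fs (List.range k) = vw at hg
        obtain ⟨v, w⟩ := vw
        simp only [Bool.and_eq_true, hasVertex_iff, allOf_eq] at hg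
        obtain ⟨hw, hg⟩ := hg
        obtain ⟨G, hG, hvG, hwG, huniq⟩ := exists_of_mem_openEnds hw
        have hv := h.lt G hG v hvG
        have hwk : w < k := by
          rcases (mem_neighbours G v w).1 hwG with h' | h'
          · exact h.lt G hG w (mem_cyclePairs h').2
          · exact h.lt G hG w (mem_cyclePairs h').1
        have hedge := (h.edge_iff hG hv hwk).2 hwG
        obtain ⟨f, hf, hfne, hef⟩ := hM.exists_other_face (h.mem G hG) hedge
        have hvf : φ v ∈ verts f := mem_verts.2 ⟨_, hef, Sym2.mem_mk_left _ _⟩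
        have hwf : φ w ∈ verts f := mem_verts.2 ⟨_, hef, Sym2.mem_mk_right _ _⟩
        have hfn : f ∉ Fs.map fun F => cycleEdges (F.map φ) := by
          intro hmem
          obtain ⟨F, hF, rfl⟩ := List.mem_map.1 hmem
          exact hfne (by rw [huniq F hF ((h.vert_iff hF hv).1 hvf) ((h.edge_iff hF hv hwk).1 hef)])
        have c1 := h.countAt_lt hM hf hfn hvf
        have c2 := h.countAt_lt hM hf hfn hwf
        have hmem : (f.card, t.count f.card) ∈ sizes :=
          ht _ (List.count_pos_iff.1 ((Nat.zero_le _).trans_lt c1))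
        have c3 : ((facesAt Fs v).all fun G => cond (hasVertex (neighbours G v) w)
            (canShare sides f.card (len G)) true) = true := by
          rw [List.all_eq_true]
          intro F hF
          rw [mem_facesAt] at hF
          cases hh : hasVertex (neighbours F v) w with
          | false => rfl
          | true =>
            have hF' := (hasVertex_iff _ _).1 hh
            obtain rfl := huniq F hF.1 hF.2 hF'
            rw [cond_true, len_eq, ← h.card_eq hG]
            exact hsides f hf _ (h.mem F hG) hfne _ hef hedge
        have hg := List.all_eq_true.1 hg _ hmem
        simp only at hg
        rw [c3, show Nat.blt (countAt Fs f.card v) _ = true by simpa using c1,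
          show Nat.blt (countAt Fs f.card w) _ = true by simpa using c2, Bool.and_self,
          Bool.and_self, cond_true] at hg
        -- The search starts from the partial cycle `w :: [v]`, so the list of the new face must end
        -- with `φ w, φ v`.
        obtain ⟨R, hR, hfR⟩ := (hM.isCycle f hf).exists_list (Sym2.eq_swap ▸ hef)
        have h3 : 3 ≤ f.card := by
          obtain ⟨l, hl, h3, rfl⟩ := hM.isCycle f hf
          rwa [card_cycleEdges hl h3]
        have hlen : R.length + 2 = f.card := by
          rw [hfR]
          have : (verts f).card = R.length + 2 := by
            rw [hfR, verts_cycleEdges, List.toFinset_card_of_nodup hR]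
            simp
          rw [← hfR, ← (hM.isCycle f hf).card_verts, this]
        have hR' : R.length = Nat.sub f.card 2 := by
          change _ = f.card - 2
          omega
        exact grow_sound hM hsides hn h3 (fun Fs k φ hc hL => ih Fs k φ hc hL) _ k w [v] φ R hg h
          (by simp [hv, hwk]) (List.cons_ne_nil _ _) rfl hR' (by rw [hfR] at hf; exact hf)
          (by rw [hfR] at hfn; exact hfn) hR (by simpa using hlen)

omit [Fintype V] in
theorem sameCycle_spec {φ : ℕ → V} {F G : List ℕ} (h : sameCycle F G = true) :
    cycleEdges (F.map φ) = cycleEdges (G.map φ) := by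
  have key : ∀ F G : List ℕ, allOf (cyclePairs F) 
      (fun p => hasVertex (neighbours G p.1) p.2) = true →
      cycleEdges (F.map φ) ⊆ cycleEdges (G.map φ) := by
    intro F G h e he
    rw [allOf_eq, List.all_eq_true] at h
    obtain ⟨p, hp, rfl⟩ := (mem_cycleEdges_map φ F e).1 he
    have := h p hp
    rw [hasVertex_iff, mem_neighbours] at this
    rw [mem_cycleEdges_map]
    rcases this with h' | h'
    · exact ⟨_, h', rfl⟩
    · exact ⟨_, h', Sym2.eq_swap⟩
  rw [sameCycle, Bool.and_eq_true] at h
  exact (key F G h.1).antisymm (key G F h.2)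

/-- When all faces around all labels are listed, a bijection `q` from the vertices of a target to
the labels that preserves the faces gives an isomorphism. -/
theorem isomorphic_of_isIso (hM : IsSemiEquivelar M t) (hn : Fintype.card V ≤ n) {φ : ℕ → V}
    {Fs : List (List ℕ)} (h : Labelled M φ n Fs)
    (hc : ∀ x < n, len (facesAt Fs x) = t.length) {L : List (List (Fin n))} {q : List ℕ}
    (hq : q.Perm (List.range n)) (hiso : isIso L Fs q = true) : Isomorphic M (ofLists L) := by
  have hlen : q.length = n := by simpa using hq.length_eq
  set r : Fin n → ℕ := fun i => q.getD i 0 with hr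
  have hri : ∀ i : Fin n, r i = q[(i : ℕ)]'(by omega) := fun i =>
    List.getD_eq_getElem _ _ (by omega)
  have hlt : ∀ i, r i < n := fun i => by
    rw [hri, ← List.mem_range, ← hq.mem_iff]
    exact List.getElem_mem _
  have hnd : q.Nodup := hq.nodup_iff.2 List.nodup_range
  set ψ : Fin n → V := fun i => φ (r i) with hψ
  have hinj : Function.Injective ψ := by
    intro i j hij
    have := h.inj _ (hlt i) _ (hlt j) hij
    rw [hri, hri, hnd.getElem_inj_iff] at this
    exact Fin.ext this
  -- There are `n` distinct labelled vertices and at most `n` vertices in all.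
  have hbij : Function.Bijective ψ := by
    refine (Fintype.bijective_iff_injective_and_card ψ).2 ⟨hinj, ?_⟩
    have := Fintype.card_le_of_injective ψ hinj
    rw [Fintype.card_fin] at this ⊢
    omega
  set e := Equiv.ofBijective ψ hbij with he
  have hmap : ∀ l : List (Fin n), cycleEdges ((l.map r).map φ) =
      (cycleEdges l).image (Sym2.map e) := by
    intro l
    rw [List.map_map, cycleEdges_map]
    rfl
  rw [isIso, Bool.and_eq_true, allOf_eq, allOf_eq, List.all_eq_true, List.all_eq_true] at hiso
  obtain ⟨h1, h2⟩ := hiso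
  have hmem : ∀ f, f ∈ M ↔ ∃ l ∈ L, (cycleEdges l).image (Sym2.map e) = f := by
    intro f
    constructor
    · intro hf
      obtain ⟨a, ha⟩ : ∃ v, v ∈ verts f := by
        obtain ⟨l, hl, h3, rfl⟩ := hM.isCycle f hf
        obtain ⟨x, hx⟩ := List.exists_mem_of_length_pos (l := l) (by omega)
        exact ⟨x, by rwa [verts_cycleEdges, List.mem_toFinset]⟩
      obtain ⟨i, rfl⟩ := hbij.2 a
      -- The listed faces at this vertex are as many as the type prescribes, so none is missing; as
      -- every vertex is labelled, every face of `M` is listed.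
      have hk : Labelled.known φ Fs (r i) = facesThrough M (φ (r i)) := by
        refine Finset.eq_of_subset_of_card_le (h.known_subset _) ?_
        rw [hM.card_facesThrough, h.card_known, hc _ (hlt i)]
      have := mem_facesThrough.2 ⟨hf, ha⟩
      rw [← hk, Labelled.mem_known] at this
      obtain ⟨F, hF, -, rfl⟩ := this
      have := h2 F hF
      rw [anyOf_eq, List.any_eq_true] at this
      obtain ⟨l, hl, hs⟩ := this
      exact ⟨l, hl, by rw [← hmap, sameCycle_spec hs]⟩
    · rintro ⟨l, hl, rfl⟩
      have := h1 l hl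
      rw [anyOf_eq, List.any_eq_true] at this
      obtain ⟨F, hF, hs⟩ := this
      rw [← hmap, sameCycle_spec hs]
      exact h.mem F hF
  refine ⟨e.symm, fun f => ?_⟩
  have hcomp : ∀ X : Finset (Sym2 (Fin n)), X.image (Sym2.map e) = f ↔
      X = f.image (Sym2.map e.symm) := by
    intro X
    constructor
    · rintro rfl
      rw [Finset.image_image, ← Sym2.map_comp]
      simp
    · rintro rfl
      rw [Finset.image_image, ← Sym2.map_comp]
      simp
  rw [hmem, ofLists, List.mem_toFinset, List.mem_map]
  exact exists_congr fun l => and_congr Iff.rfl (hcomp _)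

/-- A connected space has a point, and a point of the carrier lies in a triangle over some edge. -/
theorem IsMap.nonempty (h : IsMap M) : Nonempty V := by
  obtain ⟨-, hc⟩ := h
  obtain ⟨⟨x, -, f, e, he, -⟩⟩ := hc.toNonempty
  induction e with | _ a b => exact ⟨a⟩

/-- A successful search classifies the maps of type `t` with at most `n` vertices. -/
theorem IsSEM.exists_isomorphic (h : IsSEM M t) (hn : Fintype.card V ≤ n) {a : ℕ} (ha : a ∈ t)
    (ht : ∀ s ∈ t, (s, t.count s) ∈ sizes)
    (hsides : ∀ i : Fin t.length, canShare sides (t.get i) (t.get (finRotate _ i)) = true ∧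
      canShare sides (t.get (finRotate _ i)) (t.get i) = true)
    {targets : List (List (List (Fin n)))} {maps : List (List ℕ)}
    (hmaps : ∀ q ∈ maps, q.Perm (List.range n)) {fuel : ℕ}
    (hs : search t.length a sizes sides targets maps fuel = true) :
    ∃ L ∈ targets, Isomorphic M (ofLists L) := by
  obtain ⟨v⟩ := h.1.nonempty
  have hM := h.isSemiEquivelar
  obtain ⟨f, hf⟩ : ∃ f, f ∈ (facesThrough M v).filter fun f => f.card = a := by
    refine Finset.card_pos.1 ?_
    rw [hM.card_facesThrough_size]
    exact List.count_pos_iff.2 ha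
  rw [Finset.mem_filter, mem_facesThrough] at hf
  obtain ⟨⟨hf, -⟩, hfa⟩ := hf
  obtain ⟨l, hl, h3, rfl⟩ := hM.isCycle f hf
  rw [card_cycleEdges hl h3] at hfa
  -- The default `v` only makes the labelling total; labels below `a` never reach it.
  have hmap : (List.range a).map (fun i => l.getD i v) = l := by
    refine List.ext_getElem (by simpa using hfa.symm) fun i h1 h2 => ?_
    simp [h2]
  have hL : Labelled M (fun i => l.getD i v) a [List.range a] := by
    refine ⟨?_, ?_, ?_, ?_, ?_, ?_⟩
    · intro x hx y hy hxy
      replace hxy : l.getD x v = l.getD y v := hxy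
      rw [List.getD_eq_getElem _ _ (by omega), List.getD_eq_getElem _ _ (by omega),
        hl.getElem_inj_iff] at hxy
      exact hxy
    · rw [List.forall_mem_singleton, hmap]
      exact hf
    · simpa using List.nodup_range
    · simp
    · rw [List.forall_mem_singleton, List.length_range]
      omega
    · simp
  refine solve_sound hM ht (fun f hf g hg hfg e hef heg =>
    hM.rel_of_common_edge (p := fun a b => canShare sides a b = true) hsides hf hg hfg hef heg) hn
    (fun Fs k φ hleaf hL hc => ?_) fuel _ _ _ hs hL
  rw [leafCheck, Bool.and_eq_true, Nat.beq_eq, anyOf_eq, List.any_eq_true] at hleaf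
  obtain ⟨rfl, L, hLt, hleaf⟩ := hleaf
  rw [anyOf_eq, List.any_eq_true] at hleaf
  obtain ⟨q, hq, hiso⟩ := hleaf
  exact ⟨L, hLt, isomorphic_of_isIso hM hn hL hc (hmaps q hq) hiso⟩

end Classification

/-! ### The four types -/

section Types

variable {V : Type*} [Fintype V] [DecidableEq V] {M : Finset (Finset (Sym2 V))}

/-- If `s` does not divide `c * k` for `k = 19, 20`, then a map with at most `20` vertices and
`c` faces of size `s` at every vertex has at most `18` vertices. -/
theorem IsSEM.card_le {t : List ℕ} (h : IsSEM M t) (hV : Fintype.card V ≤ 20) (s : ℕ)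
    (h19 : ¬ s ∣ t.count s * 19) (h20 : ¬ s ∣ t.count s * 20) : Fintype.card V ≤ 18 := by
  have hd : s ∣ t.count s * Fintype.card V :=
    ⟨_, (h.isSemiEquivelar.mul_card_size s).symm⟩
  by_contra hcon
  have : Fintype.card V = 19 ∨ Fintype.card V = 20 := by omega
  rcases this with e | e <;> rw [e] at hd
  · exact h19 hd
  · exact h20 hd

/-- The labellings of the two targets found by the search for maps of type `(3,4,6,4)`. -/
def rhombitrihexagonalLabellings : List (List ℕ) :=
  [[13, 12, 11, 7, 6, 14, 4, 5, 9, 17, 3, 2, 10, 8, 0, 1, 15, 16],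
    [17, 16, 15, 9, 8, 10, 3, 4, 13, 12, 2, 1, 6, 14, 5, 0, 7, 11],
    [9, 8, 10, 17, 15, 16, 12, 13, 5, 0, 7, 11, 3, 4, 14, 6, 1, 2],
    [5, 4, 3, 2, 1, 0, 8, 9, 12, 11, 10, 17, 14, 13, 16, 15, 6, 7]]

/-- The labellings of the target found by the search for maps of type `(4,8,8)`. -/
def truncatedSquareLabellings : List (List ℕ) :=
  [[13, 14, 7, 0, 9, 10, 11, 12, 19, 15, 8, 1, 2, 17, 16, 6, 5, 4, 3, 18],
    [11, 12, 2, 1, 8, 15, 16, 17, 19, 10, 9, 0, 7, 14, 13, 3, 4, 5, 6, 18],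
    [12, 13, 0, 1, 8, 9, 10, 11, 19, 16, 15, 2, 3, 17, 14, 7, 6, 5, 4, 18],
    [10, 11, 3, 2, 15, 16, 17, 18, 19, 9, 8, 1, 0, 13, 12, 4, 5, 6, 7, 14]]

/-- The labellings of the target found by the search for maps of type `(3,3,3,3,6)`. -/
def snubHexagonalLabellings : List (List ℕ) :=
  [[15, 17, 14, 16, 8, 7, 10, 3, 4, 13, 9, 1, 2, 11, 12, 5, 0, 6],
    [12, 13, 6, 7, 10, 11, 16, 5, 4, 17, 9, 1, 0, 8, 15, 3, 2, 14]]

/-- The face lists of `T18_3464`. -/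
def T18_3464_lists : List (List (Fin 18)) :=
  [[0, 7, 8], [1, 9, 10], [2, 11, 12], [3, 13, 14], [4, 15, 16], [5, 6, 17], [0, 1, 9, 8],
  [0, 5, 6, 7], [1, 2, 11, 10], [2, 3, 13, 12], [3, 4, 15, 14], [4, 5, 17, 16],
  [6, 11, 12, 17], [7, 8, 13, 14], [9, 10, 15, 16], [0, 1, 2, 3, 4, 5],
  [6, 7, 14, 15, 10, 11], [8, 9, 16, 17, 12, 13]]

/-- The face lists of `K18_3464`. -/
def K18_3464_lists : List (List (Fin 18)) :=
  [[0, 7, 8], [1, 9, 10], [2, 11, 12], [3, 13, 14], [4, 15, 16], [5, 6, 17], [0, 1, 9, 8],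
  [0, 5, 6, 7], [1, 2, 11, 10], [2, 3, 13, 12], [3, 4, 15, 14], [4, 5, 17, 16],
  [6, 10, 9, 17], [7, 8, 13, 14], [11, 12, 16, 15], [0, 1, 2, 3, 4, 5],
  [6, 7, 14, 15, 11, 10], [8, 9, 17, 16, 12, 13]]

/-- The face lists of `T20_488`. -/
def T20_488_lists : List (List (Fin 20)) :=
  [[0, 7, 8, 9], [1, 2, 15, 14], [3, 4, 10, 11], [5, 6, 16, 17], [12, 13, 19, 18],
  [0, 1, 2, 3, 4, 5, 6, 7], [0, 1, 14, 13, 12, 11, 10, 9], [2, 3, 11, 12, 18, 17, 16, 15],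
  [4, 5, 17, 18, 19, 8, 9, 10], [6, 7, 8, 19, 13, 14, 15, 16]]

/-- The face lists of `T18_33336`. -/
def T18_33336_lists : List (List (Fin 18)) :=
  [[0, 1, 8], [0, 5, 6], [0, 6, 7], [0, 7, 8], [1, 2, 10], [1, 8, 9], [1, 9, 10], [2, 3, 12],
  [2, 10, 11], [2, 11, 12], [3, 4, 14], [3, 12, 13], [3, 13, 14], [4, 5, 16], [4, 14, 15],
  [4, 15, 16], [5, 6, 17], [5, 16, 17], [6, 7, 13], [7, 12, 13], [8, 9, 15], [9, 14, 15],
  [10, 11, 17], [11, 16, 17], [0, 1, 2, 3, 4, 5], [6, 13, 14, 9, 10, 17],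
  [7, 8, 15, 16, 11, 12]]

theorem IsSEM.isomorphic_of_3464 (hV : Fintype.card V ≤ 20)
    (h : IsSEM M [3, 4, 6, 4]) :
    Isomorphic M T18_3464 ∨ Isomorphic M K18_3464 := by
  obtain ⟨L, hL, hiso⟩ := h.exists_isomorphic (n := 18) (a := 6)
    (sizes := [(3, 1), (4, 2), (6, 1)]) (sides := [(3, 4), (4, 3), (4, 6), (6, 4)])
    (targets := [T18_3464_lists, K18_3464_lists]) (maps := rhombitrihexagonalLabellings) (fuel := 40)
    -- One hexagon at each vertex forces 6 to divide the number of vertices.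
    (h.card_le hV 6 (by decide) (by decide)) (by decide) (by decide) (by decide +kernel) (by decide +kernel)
    (by decide +kernel)
  rcases List.mem_cons.1 hL with rfl | hL
  · exact Or.inl hiso
  · rw [List.mem_singleton.1 hL] at hiso
    exact Or.inr hiso

theorem IsSEM.isomorphic_of_488 (hV : Fintype.card V ≤ 20)
    (h : IsSEM M [4, 8, 8]) :
    Isomorphic M T20_488 := by
  obtain ⟨L, hL, hiso⟩ := h.exists_isomorphic (n := 20) (a := 8)
    (sizes := [(4, 1), (8, 2)]) (sides := [(4, 8), (8, 4), (8, 8)])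
    (targets := [T20_488_lists]) (maps := truncatedSquareLabellings) (fuel := 40)
    hV (by decide) (by decide) (by decide +kernel) (by decide +kernel)
    (by decide +kernel)
  rw [List.mem_singleton.1 hL] at hiso
  exact hiso

theorem IsSEM.isomorphic_of_33336 (hV : Fintype.card V ≤ 20)
    (h : IsSEM M [3, 3, 3, 3, 6]) :
    Isomorphic M T18_33336 := by
  obtain ⟨L, hL, hiso⟩ := h.exists_isomorphic (n := 18) (a := 6)
    (sizes := [(3, 4), (6, 1)]) (sides := [(3, 3), (3, 6), (6, 3)])
    (targets := [T18_33336_lists]) (maps := snubHexagonalLabellings) (fuel := 40)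
    (h.card_le hV 6 (by decide) (by decide)) (by decide) (by decide) (by decide +kernel) (by decide +kernel)
    (by decide +kernel)
  rw [List.mem_singleton.1 hL] at hiso
  exact hiso

/-- With no targets every leaf is rejected, so a successful search means that no branch reaches a
leaf. -/
theorem IsSEM.false_of_3636 (hV : Fintype.card V ≤ 20)
    (h : IsSEM M [3, 6, 3, 6]) :
    False := by
  obtain ⟨L, hL, hiso⟩ := h.exists_isomorphic (n := 18) (a := 6)
    (sizes := [(3, 2), (6, 2)]) (sides := [(3, 6), (6, 3)])
    (targets := []) (maps := []) (fuel := 40)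
    -- Two hexagons at each vertex: 6 divides neither 38 nor 40.
    (h.card_le hV 6 (by decide) (by decide)) (by decide) (by decide) (by decide +kernel) (by decide +kernel)
    (by decide +kernel)
  exact absurd hL List.not_mem_nil

end Types

end PolyMap

theorem lemma2 {V : Type*} [Fintype V] [DecidableEq V] (M : Finset (Finset (Sym2 V)))
    (hV : Fintype.card V ≤ 20) (hM : PolyMap.OnTorus M ∨ PolyMap.OnKleinBottle M) :
    (PolyMap.IsSEM M [3, 4, 6, 4] →
      PolyMap.Isomorphic M PolyMap.T18_3464 ∨ PolyMap.Isomorphic M PolyMap.K18_3464) ∧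
    (PolyMap.IsSEM M [4, 8, 8] → PolyMap.Isomorphic M PolyMap.T20_488) ∧
    (PolyMap.IsSEM M [3, 3, 3, 3, 6] → PolyMap.Isomorphic M PolyMap.T18_33336) ∧
    ¬ PolyMap.IsSEM M [3, 6, 3, 6] :=
  ⟨fun h => h.isomorphic_of_3464 hV, fun h => h.isomorphic_of_488 hV,
    fun h => h.isomorphic_of_33336 hV, fun h => h.false_of_3636 hV⟩
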